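/- All graphs are finite and simple. $W_7$ is the wheel with seven spokes, and a graph contains a $W_7$-subdivision if some subgraph of it is a subdivision of $W_7$. A type 1 edge-vertex-cutset of a graph $G$ is a set $S=\{e_1,e_2,v\}$ consisting of two edges $e_1,e_2$ and one vertex $v$ of $G$ such that $G-S$ (delete the two edges and the vertex) is disconnected and each of its components has at least four vertices. Theorem. Let $G$ be a 3-connected graph with a type 1 edge-vertex-cutset $S=\{e_1,e_2,v\}$, and let $G_1,G_2$ be the components of $G-S$ (there are exactly two, and each of $e_1$, $e_2$ has one end in each of them). Let $u_1,\dots,u_i$ be the neighbours of $v$ in $G_1$ and $v_1,\dots,v_j$ the neighbours of $v$ in $G_2$, each listed without repetition in any order. Let $G_1'$ be the graph obtained from $G$ by replacing $G_2$ with the following graph $X$: - if $j<3$, $X$ is the complete graph on $v_1,\dots,v_j$; - if $j\ge 3$, $X$ is the path $v_1v_2v_3$ (its only edges are $v_1v_2$ and $v_2v_3$). Here the subgraph of $G$ induced on $V(G_1)\cup\{v\}$ is unchanged, every vertex of $X$ is adjacent to $v$, the end of $e_1$ outside $G_1$ becomes $v_1$, and the end of $e_2$ outside $G_1$ becomes $v_{\min(j,3)}$;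 there are no other edges. Let $G_2'$ be obtained in the same way with the roles of the two sides exchanged: $G_1$ is replaced with $Y$, the complete graph on $u_1,\dots,u_i$ if $i<3$ and the path $u_1u_2u_3$ if $i\ge 3$, where every vertex of $Y$ is adjacent to $v$, the end of $e_1$ outside $G_2$ becomes $u_1$, and the end of $e_2$ outside $G_2$ becomes $u_{\min(i,3)}$. Then $G$ contains a $W_7$-subdivision if and only if at least one of $G_1'$ and $G_2'$ contains a $W_7$-subdivision. -/

import Mathlib

/-- `G` is `k`-connected: it has more than `k` vertices, and deleting any set of fewer than `k`
vertices leaves a connected graph. -/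
def IsKConnected {V : Type*} (G : SimpleGraph V) (k : ℕ) : Prop :=
  k < Nat.card V ∧ ∀ S : Finset V, S.card < k → (G.induce {x | x ∉ S}).Connected

/-- The wheel `W_n` with `n` spokes: the hub `none` is joined to every vertex of a rim, which is a
cycle on `Fin n`. -/
def wheelGraph (n : ℕ) : SimpleGraph (Option (Fin n)) :=
  SimpleGraph.fromRel fun x y =>
    x = none ∨ ∃ i k : Fin n, x = some i ∧ y = some k ∧ (SimpleGraph.cycleGraph n).Adj i k

/-- `z` is an internal vertex of the walk `p` (for a path: a vertex other than its two ends). -/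
def IsInternalVertex {V : Type*} {G : SimpleGraph V} {x y : V} (p : G.Walk x y) (z : V) : Prop :=
  z ∈ p.support ∧ z ≠ x ∧ z ≠ y

/-- `G` contains a subdivision of `H` (an `H`-subdivision) as a subgraph: there are distinct branch
vertices `f a`, one for each vertex `a` of `H`, and for every edge `ab` of `H` a path from `f a` to
`f b` in `G`, such that no branch vertex is internal to any of these paths, and paths that belong
to different edges of `H` share no internal vertex. (An edge is listed here in both directions;
the two paths chosen for the two directions need not be related.) -/
def ContainsSubdivision {W V : Type*} (H : SimpleGraph W) (G : SimpleGraph V) : Prop :=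
  ∃ f : W → V, Function.Injective f ∧
    ∃ P : ∀ a b : W, H.Adj a b → G.Walk (f a) (f b),
      (∀ a b (h : H.Adj a b), (P a b h).IsPath) ∧
      (∀ a b (h : H.Adj a b) (c : W), ¬ IsInternalVertex (P a b h) (f c)) ∧
      (∀ a b (h : H.Adj a b) c d (h' : H.Adj c d), s(a, b) ≠ s(c, d) →
        ∀ z, ¬ (IsInternalVertex (P a b h) z ∧ IsInternalVertex (P c d h') z))

/-- The graph `G - S` for `S = {e₁, e₂, v}`: delete the two edges `e₁`, `e₂` and the vertex `v`. -/
def edgeVertexRemoval {V : Type*} (G : SimpleGraph V) (e₁ e₂ : Sym2 V) (v : V) :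
    SimpleGraph {x : V // x ≠ v} :=
  (G.deleteEdges {e₁, e₂}).induce {x | x ≠ v}

/-- `{e₁, e₂, v}` is a type 1 edge-vertex-cutset of `G`: `e₁`, `e₂` are two edges of `G`, and the
graph `G - {e₁, e₂, v}` is disconnected, with each component having at least four vertices. -/
def IsType1EdgeVertexCutset {V : Type*} (G : SimpleGraph V) (e₁ e₂ : Sym2 V) (v : V) : Prop :=
  e₁ ∈ G.edgeSet ∧ e₂ ∈ G.edgeSet ∧ e₁ ≠ e₂ ∧
    ¬ (edgeVertexRemoval G e₁ e₂ v).Preconnected ∧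
    ∀ C : (edgeVertexRemoval G e₁ e₂ v).ConnectedComponent, 4 ≤ C.supp.ncard

/-- The vertices of a component of `G - {e₁, e₂, v}`, as a set of vertices of `G`. -/
def componentVerts {V : Type*} {G : SimpleGraph V} {e₁ e₂ : Sym2 V} {v : V}
    (C : (edgeVertexRemoval G e₁ e₂ v).ConnectedComponent) : Set V :=
  Subtype.val '' C.supp

/-- The vertices of the graph in which the side of the cutset `{e₁, e₂, v}` other than `A` has been
replaced: those of `A`, the vertex `v`, and the first three (or all, if there are fewer) of the
vertices `w 0, …, w (m - 1)`. -/
def replacedVerts {V : Type*} (v : V) (A : Set V) {m : ℕ} (w : Fin m → V) : Set V :=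
  {x | x ∈ A ∨ x = v ∨ ∃ k : Fin m, (k : ℕ) < 3 ∧ x = w k}

/-- The graph obtained from `G` by replacing the side of the cutset `{e₁, e₂, v}` other than `A`,
where `w 0, …, w (m - 1)` are the neighbours of `v` on the side that is replaced.
Put `r = min m 3`. The new side is the path `w 0, …, w (r - 1)`: one vertex if `m = 1`, two
adjacent vertices if `m = 2`, and a path with middle vertex `w 1` if `m ≥ 3`. All its vertices are
adjacent to `v`, the edge `e₁` now joins its end in `A` to `w 0`, and the edge `e₂` now joins its
end in `A` to `w (r - 1)`. Nothing changes on `A ∪ {v}`. -/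
def replaceSide {V : Type*} (G : SimpleGraph V) (e₁ e₂ : Sym2 V) (v : V) (A : Set V) {m : ℕ}
    (w : Fin m → V) : SimpleGraph (replacedVerts v A w) :=
  (SimpleGraph.fromRel fun x y : V =>
    ((x ∈ A ∨ x = v) ∧ (y ∈ A ∨ y = v) ∧ G.Adj x y) ∨
    (∃ k : Fin m, (k : ℕ) < 3 ∧ x = v ∧ y = w k) ∨
    (∃ k l : Fin m, (l : ℕ) < 3 ∧ (k : ℕ) + 1 = (l : ℕ) ∧ x = w k ∧ y = w l) ∨
    (∃ k : Fin m, (k : ℕ) = 0 ∧ x ∈ A ∧ x ∈ e₁ ∧ y = w k) ∨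
    (∃ k : Fin m, (k : ℕ) + 1 = min m 3 ∧ x ∈ A ∧ x ∈ e₂ ∧ y = w k)).induce
      (replacedVerts v A w)

/-! A subdivision of the wheel amounts to a hub vertex and seven disjoint connected bags in cyclic
order, consecutive bags joined by an edge and each bag containing a neighbour of the hub
(`containsSubdivision_wheelGraph_iff`): only three edges need to leave a bag, so a tripod inside it
recovers the branch vertex. All rerouting is done with bags.

By 3-connectedness the cutset splits `G` into exactly two sides `A` and `B`, joined to each other
only by `a₁b₁` and `a₂b₂`, whose ends on each side are distinct (`exists_isSplit`).

From a replaced graph back to `G`: the vertices of the new path are expanded into disjoint connected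
subsets of the replaced side, each with a neighbour of `v`, the first containing `b₁` and the last
`b₂`. These are cut out of an st-numbering of the side (`IsSplit.exists_numbering`), which exists
because no two vertices separate `G`. A vertex of the new path has too few neighbours to be the hub.

From `G` to a replaced graph: the side of the hub is kept. If the hub is `v`, the bags that see `v`
only through `A` and those that see it only through `B` are disjoint families among seven bags, so
one family has at most three members, and that side is replaced. Say it is `B`, with family `Q`. A
connected set can cross the border of `B` only by three passes, at `a₁`, `a₂` and `v`, and each of
these vertices lies in at most one bag. When `Q` is empty, a bag or rim edge is destroyed by
deleting `B` only if it uses two passes; any two destroyed ones then share a bag, and since the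
7-cycle has no triangle some bag meets them all and can take the whole new path. If `Q` has one
member, the hub occupies one of the three border vertices, and with two passes left that member can
take the path. If `Q` has two or three members, the hub is `v`: two members take opposite ends of
the path, and three must be consecutive and take one vertex each. -/

/-! ### Connectedness inside a vertex set -/

/-- `x` and `y` are joined by a walk of `G` inside `s`. -/
def ReachIn {V : Type*} (G : SimpleGraph V) (s : Set V) : V → V → Prop :=
  Relation.ReflTransGen fun a b => G.Adj a b ∧ a ∈ s ∧ b ∈ s

/-- `s` is nonempty and induces a connected subgraph of `G`. -/
def ConnOn {V : Type*} (G : SimpleGraph V) (s : Set V) : Prop :=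
  s.Nonempty ∧ ∀ x ∈ s, ∀ y ∈ s, ReachIn G s x y

section ReachIn

variable {V V' : Type*} {G : SimpleGraph V} {s t : Set V} {x y z : V}

theorem ReachIn.refl (x : V) : ReachIn G s x x := Relation.ReflTransGen.refl

theorem ReachIn.of_adj (h : G.Adj x y) (hx : x ∈ s) (hy : y ∈ s) : ReachIn G s x y :=
  Relation.ReflTransGen.single ⟨h, hx, hy⟩

theorem ReachIn.trans (h : ReachIn G s x y) (h' : ReachIn G s y z) : ReachIn G s x z :=
  Relation.ReflTransGen.trans h h'

theorem ReachIn.symm (h : ReachIn G s x y) : ReachIn G s y x := by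
  induction h with
  | refl => exact .refl _
  | tail _ h ih => exact (ReachIn.of_adj h.1.symm h.2.2 h.2.1).trans ih

theorem ReachIn.mono (hst : s ⊆ t) (h : ReachIn G s x y) : ReachIn G t x y := by
  induction h with
  | refl => exact .refl _
  | tail _ h ih => exact ih.trans (.of_adj h.1 (hst h.2.1) (hst h.2.2))

/-- Edges may go to walks, even trivial ones, so `π` can be a contraction. -/
theorem ReachIn.map {F : SimpleGraph V'} {U : Set V'} (π : V → V')
    (hadj : ∀ a ∈ s, ∀ b ∈ s, G.Adj a b → ReachIn F U (π a) (π b))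
    (h : ReachIn G s x y) : ReachIn F U (π x) (π y) := by
  induction h with
  | refl => exact .refl _
  | tail _ h ih => exact ih.trans (hadj _ h.2.1 _ h.2.2 h.1)

theorem ReachIn.exists_adj {T : Set V} (h : ReachIn G s x y) (hx : x ∈ T) (hy : y ∉ T) :
    ∃ p ∈ s, p ∈ T ∧ ∃ q ∈ s, q ∉ T ∧ G.Adj p q := by
  induction h with
  | refl => exact absurd hx hy
  | @tail b c _ h ih =>
    by_cases hb : b ∈ T
    · exact ⟨b, h.2.1, hb, c, h.2.2, hy, h.1⟩
    · exact ih hb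

theorem ConnOn.exists_adj {T : Set V} (h : ConnOn G s) (hx : x ∈ s) (hxT : x ∈ T) (hy : y ∈ s)
    (hyT : y ∉ T) : ∃ p ∈ s, p ∈ T ∧ ∃ q ∈ s, q ∉ T ∧ G.Adj p q :=
  (h.2 x hx y hy).exists_adj hxT hyT

theorem ConnOn.of_root (hx : x ∈ s) (h : ∀ y ∈ s, ReachIn G s x y) : ConnOn G s :=
  ⟨⟨x, hx⟩, fun a ha b hb => (h a ha).symm.trans (h b hb)⟩

theorem ConnOn.singleton (x : V) : ConnOn G {x} :=
  .of_root rfl (by rintro y rfl; exact .refl _)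

/-- Surjectivity is needed only up to reachability, so that `U` may contain new vertices outside the
image of `π`. -/
theorem ConnOn.map {F : SimpleGraph V'} {U : Set V'} (hs : ConnOn G s) (π : V → V')
    (hmem : ∀ a ∈ s, π a ∈ U)
    (hadj : ∀ a ∈ s, ∀ b ∈ s, G.Adj a b → ReachIn F U (π a) (π b))
    (hsurj : ∀ u ∈ U, ∃ a ∈ s, ReachIn F U (π a) u) : ConnOn F U := by
  obtain ⟨⟨x, hx⟩, h⟩ := hs
  refine .of_root (hmem x hx) fun u hu => ?_
  obtain ⟨a, ha, hau⟩ := hsurj u hu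
  exact ((h x hx a ha).map π hadj).trans hau

theorem ConnOn.union (hs : ConnOn G s) (ht : ConnOn G t) (hx : x ∈ s) (hy : y ∈ t)
    (hxy : x = y ∨ G.Adj x y) : ConnOn G (s ∪ t) := by
  refine .of_root (Or.inl hx) ?_
  have hxy' : ReachIn G (s ∪ t) x y := by
    rcases hxy with rfl | h
    · exact .refl _
    · exact .of_adj h (Or.inl hx) (Or.inr hy)
  rintro z (hz | hz)
  · exact (hs.2 x hx z hz).mono Set.subset_union_left
  · exact hxy'.trans ((ht.2 y hy z hz).mono Set.subset_union_right)

/-- `ReachIn` is reflexive also outside `s`, so the trivial walk needs `x ∈ s`. -/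
theorem ReachIn.exists_walk (h : ReachIn G s x y) (hx : x ∈ s) :
    ∃ p : G.Walk x y, ∀ z ∈ p.support, z ∈ s := by
  induction h with
  | refl => exact ⟨.nil, by simpa using hx⟩
  | tail _ h ih =>
    obtain ⟨p, hp⟩ := ih
    refine ⟨p.concat h.1, fun z hz => ?_⟩
    rw [SimpleGraph.Walk.support_concat] at hz
    simp only [List.mem_append, List.mem_singleton] at hz
    rcases hz with hz | rfl
    · exact hp z hz
    · exact h.2.2

theorem ReachIn.exists_path (h : ReachIn G s x y) (hx : x ∈ s) :
    ∃ p : G.Walk x y, p.IsPath ∧ ∀ z ∈ p.support, z ∈ s := by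
  classical
  obtain ⟨p, hp⟩ := h.exists_walk hx
  exact ⟨p.bypass, p.bypass_isPath, fun z hz => hp z (p.support_bypass_subset_support hz)⟩

theorem ReachIn.of_walk (p : G.Walk x y) (hp : ∀ z ∈ p.support, z ∈ s) : ReachIn G s x y := by
  induction p with
  | nil => exact .refl _
  | cons h q ih =>
    refine (ReachIn.of_adj h (hp _ (by simp)) (hp _ (by simp))).trans (ih fun z hz => hp z ?_)
    simp [hz]

/-- The initial part of a path, without its last vertex, is connected and has a neighbour of the
last vertex. -/
theorem connOn_support_diff_end (p : G.Walk x y) (hp : p.IsPath) (hxy : x ≠ y) :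
    ConnOn G {z | z ∈ p.support ∧ z ≠ y} ∧ ∃ z ∈ p.support, z ≠ y ∧ G.Adj z y := by
  induction p with
  | nil => exact absurd rfl hxy
  | @cons a b c h q ih =>
    rw [SimpleGraph.Walk.cons_isPath_iff] at hp
    by_cases hbc : b = c
    · subst hbc
      have hq : q = .nil := (SimpleGraph.Walk.isPath_iff_nil.1 hp.1).eq_nil
      subst hq
      refine ⟨?_, a, by simp, hxy, h⟩
      convert ConnOn.singleton (G := G) a using 1
      ext z
      simp only [SimpleGraph.Walk.support_cons, SimpleGraph.Walk.support_nil, List.mem_cons,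
        List.not_mem_nil, or_false, Set.mem_ofPred_eq, Set.mem_singleton_iff]
      constructor
      · rintro ⟨h1 | h1, h2⟩
        · exact h1
        · exact absurd h1 h2
      · rintro rfl
        exact ⟨Or.inl rfl, hxy⟩
    · obtain ⟨h1, z, hz, hzc, hadj⟩ := ih hp.1 hbc
      refine ⟨?_, z, by simp [hz], hzc, hadj⟩
      convert (ConnOn.singleton (G := G) a).union h1 (x := a) (y := b) rfl ⟨by simp, hbc⟩
        (Or.inr h) using 1
      ext z
      simp only [SimpleGraph.Walk.support_cons, List.mem_cons, Set.mem_ofPred_eq, Set.mem_union,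
        Set.mem_singleton_iff]
      constructor
      · rintro ⟨h1 | h1, h2⟩
        · exact Or.inl h1
        · exact Or.inr ⟨h1, h2⟩
      · rintro (rfl | ⟨h1, h2⟩)
        · exact ⟨Or.inl rfl, hxy⟩
        · exact ⟨Or.inr h1, h2⟩

/-- A walk that ends in `T` has an initial part that meets `T` only in its last vertex. -/
theorem exists_walk_to_first {T : Set V} (p : G.Walk x y) (hy : y ∈ T) :
    ∃ c ∈ T, ∃ q : G.Walk x c, (∀ z ∈ q.support, z ∈ p.support) ∧ ∀ z ∈ q.support, z ∈ T → z = c := by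
  induction p with
  | nil => exact ⟨_, hy, .nil, by simp, by simp⟩
  | @cons a b d h p ih =>
    by_cases ha : a ∈ T
    · exact ⟨a, ha, .nil, by simp, by simp⟩
    · obtain ⟨c, hc, q, hq, hqT⟩ := ih hy
      refine ⟨c, hc, .cons h q, ?_, ?_⟩
      · intro z hz
        simp only [SimpleGraph.Walk.support_cons, List.mem_cons] at hz ⊢
        exact hz.imp_right (hq z)
      · intro z hz hzT
        simp only [SimpleGraph.Walk.support_cons, List.mem_cons] at hz
        rcases hz with rfl | hz
        · exact absurd hzT ha
        · exact hqT z hz hzT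

/-- In a connected vertex set, three vertices are joined to a common vertex by three paths that
pairwise meet only there. -/
theorem ConnOn.exists_tripod (hs : ConnOn G s) (t : Fin 3 → V) (ht : ∀ i, t i ∈ s) :
    ∃ c ∈ s, ∃ p : ∀ i, G.Walk c (t i), (∀ i, (p i).IsPath) ∧ (∀ i, ∀ z ∈ (p i).support, z ∈ s) ∧
      ∀ i j, i ≠ j → ∀ z, z ∈ (p i).support → z ∈ (p j).support → z = c := by
  classical
  -- `P` joins the last two vertices; a walk from the first one is stopped at its first vertex `c`
  -- on `P`, and `P` is split at `c`.
  obtain ⟨P, hP, hPs⟩ := (hs.2 _ (ht 1) _ (ht 2)).exists_path (ht 1)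
  obtain ⟨R, hRs⟩ := (hs.2 _ (ht 0) _ (ht 1)).exists_walk (ht 0)
  obtain ⟨c, hc, q, hq, hqT⟩ := exists_walk_to_first (T := {z | z ∈ P.support}) R (by simp)
  have hc' : c ∈ P.support := hc
  have hq1 : ∀ z ∈ q.bypass.reverse.support, z ∈ q.support := fun z hz => by
    rw [SimpleGraph.Walk.support_reverse, List.mem_reverse] at hz
    exact q.support_bypass_subset_support hz
  have hT : ∀ z ∈ (P.takeUntil c hc').reverse.support, z ∈ P.support := fun z hz => by
    rw [SimpleGraph.Walk.support_reverse, List.mem_reverse] at hz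
    exact P.support_takeUntil_subset_support hc' hz
  have hD : ∀ z ∈ (P.dropUntil c hc').support, z ∈ P.support := fun z hz =>
    P.support_dropUntil_subset_support hc' hz
  have h12 : ∀ z, z ∈ (P.takeUntil c hc').reverse.support → z ∈ (P.dropUntil c hc').support →
      z = c := by
    intro z hz1 hz2
    rw [SimpleGraph.Walk.support_reverse, List.mem_reverse] at hz1
    have hn := hP.support_nodup
    rw [← P.take_spec hc', SimpleGraph.Walk.support_append] at hn
    by_contra hzc
    refine (List.disjoint_of_nodup_append hn) hz1 ?_
    rw [← SimpleGraph.Walk.cons_tail_support] at hz2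
    exact (List.mem_cons.1 hz2).resolve_left hzc
  refine ⟨c, hPs c hc, Fin.cons q.bypass.reverse (Fin.cons (P.takeUntil c hc').reverse
    (Fin.cons (P.dropUntil c hc') (fun i => i.elim0))), ?_, ?_, ?_⟩
  · intro i
    fin_cases i
    · exact q.bypass_isPath.reverse
    · exact (hP.takeUntil hc').reverse
    · exact hP.dropUntil hc'
  · intro i z
    fin_cases i
    · exact fun hz => hRs z (hq z (hq1 z hz))
    · exact fun hz => hPs z (hT z hz)
    · exact fun hz => hPs z (hD z hz)
  · intro i j hij z
    fin_cases i <;> fin_cases j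
    · exact absurd rfl hij
    · exact fun h1 h2 => hqT z (hq1 z h1) (hT z h2)
    · exact fun h1 h2 => hqT z (hq1 z h1) (hD z h2)
    · exact fun h1 h2 => hqT z (hq1 z h2) (hT z h1)
    · exact absurd rfl hij
    · exact fun h1 h2 => h12 z h1 h2
    · exact fun h1 h2 => hqT z (hq1 z h2) (hD z h1)
    · exact fun h1 h2 => h12 z h2 h1
    · exact absurd rfl hij

end ReachIn

/-! ### Wheel subdivisions and bag models -/

/-- `h` is the hub and the sets `K k` are the contracted rim vertices of a `W₇`-minor of `G` whose
hub is a single vertex. -/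
structure IsWheelModel {V : Type*} (G : SimpleGraph V) (h : V) (K : Fin 7 → Set V) : Prop where
  conn : ∀ k, ConnOn G (K k)
  disj : ∀ k l, k ≠ l → ∀ x ∈ K k, x ∉ K l
  hub : ∀ k, h ∉ K k
  spoke : ∀ k, ∃ x ∈ K k, G.Adj h x
  rim : ∀ k l, (SimpleGraph.cycleGraph 7).Adj k l → ∃ x ∈ K k, ∃ y ∈ K l, G.Adj x y

/-- Adjacency as arithmetic in `Fin 7`, the form in which finite checks are decided below. -/
theorem cycleGraph_seven_adj (k l : Fin 7) :
    (SimpleGraph.cycleGraph 7).Adj k l ↔ l = k + 1 ∨ k = l + 1 := by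
  rw [SimpleGraph.cycleGraph_adj]
  revert k l
  decide

theorem wheelGraph_adj_none {n : ℕ} (k : Fin n) : (wheelGraph n).Adj none (some k) := by
  simp [wheelGraph]

theorem wheelGraph_adj_some {n : ℕ} (k l : Fin n) :
    (wheelGraph n).Adj (some k) (some l) ↔ (SimpleGraph.cycleGraph n).Adj k l := by
  simp only [wheelGraph, SimpleGraph.fromRel_adj]
  constructor
  · rintro ⟨-, (h | ⟨i, j, hi, hj, h⟩) | (h | ⟨i, j, hi, hj, h⟩)⟩
    · cases h
    · cases hi; cases hj; exact h
    · cases h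
    · cases hi; cases hj; exact h.symm
  · intro h
    exact ⟨fun e => h.ne (Option.some.inj e), Or.inl (Or.inr ⟨k, l, rfl, rfl, h⟩)⟩

/-- The bag of a rim vertex is its spoke path without the hub together with the path to the next rim
vertex without its end. -/
theorem IsWheelModel.of_containsSubdivision {V : Type*} {G : SimpleGraph V}
    (hG : ContainsSubdivision (wheelGraph 7) G) : ∃ h K, IsWheelModel G h K := by
  obtain ⟨f, hf, P, hP, hPb, hPd⟩ := hG
  have hr : ∀ k : Fin 7, (wheelGraph 7).Adj (some k) (some (k + 1)) := fun k => by
    rw [wheelGraph_adj_some, cycleGraph_seven_adj]; exact Or.inl rfl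
  have hs : ∀ k : Fin 7, (wheelGraph 7).Adj (some k) none := fun k => (wheelGraph_adj_none k).symm
  have hne : ∀ k : Fin 7, k ≠ k + 1 := by decide
  have hA : ∀ k : Fin 7, f (some k) ≠ f none := fun k e => by cases hf e
  have hB : ∀ k : Fin 7, f (some k) ≠ f (some (k + 1)) := fun k e =>
    hne k (Option.some.inj (hf e))
  let K1 : Fin 7 → Set V := fun k => {z | z ∈ (P _ _ (hs k)).support ∧ z ≠ f none}
  let K2 : Fin 7 → Set V := fun k => {z | z ∈ (P _ _ (hr k)).support ∧ z ≠ f (some (k + 1))}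
  have h1 : ∀ k, f (some k) ∈ K1 k := fun k => ⟨by simp, hA k⟩
  have h2 : ∀ k, f (some k) ∈ K2 k := fun k => ⟨by simp, hB k⟩
  have c1 := fun k => connOn_support_diff_end _ (hP _ _ (hs k)) (hA k)
  have c2 := fun k => connOn_support_diff_end _ (hP _ _ (hr k)) (hB k)
  -- Every vertex of a bag is its branch vertex or internal to one of its two paths, so disjointness
  -- reduces to the conditions on a subdivision.
  have key : ∀ k, ∀ z ∈ K1 k ∪ K2 k, z = f (some k) ∨ ∃ b, ∃ hb : (wheelGraph 7).Adj (some k) b,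
      (b = none ∨ b = some (k + 1)) ∧ IsInternalVertex (P _ _ hb) z := by
    intro k z hz
    by_cases hzk : z = f (some k)
    · exact Or.inl hzk
    · right
      rcases hz with hz | hz
      · exact ⟨_, hs k, Or.inl rfl, hz.1, hzk, hz.2⟩
      · exact ⟨_, hr k, Or.inr rfl, hz.1, hzk, hz.2⟩
  refine ⟨f none, fun k => K1 k ∪ K2 k, ?_, ?_, ?_, ?_, ?_⟩
  · exact fun k => (c1 k).1.union (c2 k).1 (h1 k) (h2 k) (Or.inl rfl)
  · intro k l hkl z hz hz'
    rcases key k z hz with rfl | ⟨b, hb, hb', hi⟩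
    · rcases key l _ hz' with e | ⟨d, hd, hd', hj⟩
      · exact hkl (Option.some.inj (hf e))
      · exact hPb _ _ _ _ hj
    · rcases key l _ hz' with rfl | ⟨d, hd, hd', hj⟩
      · exact hPb _ _ _ _ hi
      · refine hPd _ _ hb _ _ hd ?_ z ⟨hi, hj⟩
        have : ∀ k l : Fin 7, l = k + 1 → k = l + 1 → False := by decide
        rcases hb' with rfl | rfl <;> rcases hd' with rfl | rfl
        · simpa using hkl
        · simp
        · simp
        · intro e
          simp only [Sym2.eq_iff, Option.some.injEq] at e
          rcases e with e | e
          · exact hkl e.1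
          · exact this l k e.1 e.2.symm
  · intro k hk
    rcases key k _ hk with e | ⟨b, hb, -, hi⟩
    · exact hA k e.symm
    · exact hPb _ _ _ _ hi
  · intro k
    obtain ⟨z, hz, hzn, hadj⟩ := (c1 k).2
    exact ⟨z, Or.inl ⟨hz, hzn⟩, hadj.symm⟩
  · intro k l hkl
    rw [cycleGraph_seven_adj] at hkl
    rcases hkl with rfl | rfl
    · obtain ⟨z, hz, hzn, hadj⟩ := (c2 k).2
      exact ⟨z, Or.inr ⟨hz, hzn⟩, _, Or.inl (h1 _), hadj⟩
    · obtain ⟨z, hz, hzn, hadj⟩ := (c2 l).2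
      exact ⟨_, Or.inl (h1 _), z, Or.inr ⟨hz, hzn⟩, hadj.symm⟩

/-- A subdivision is obtained from disjoint vertex sets, one for each vertex of `H`, in which the
branch vertex is joined by internally disjoint paths to the ends of the edges that leave the set. -/
theorem containsSubdivision_of_legs {W V : Type*} {H : SimpleGraph W} {G : SimpleGraph V}
    (K : W → Set V) (hK : ∀ a b, a ≠ b → ∀ x ∈ K a, x ∉ K b) (f : W → V) (t : W → W → V)
    (p : ∀ a b, H.Adj a b → G.Walk (f a) (t a b)) (hfK : ∀ a, f a ∈ K a)
    (hp : ∀ a b h, (p a b h).IsPath) (hpK : ∀ a b h, ∀ z ∈ (p a b h).support, z ∈ K a)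
    (hpd : ∀ a b h b' h', b ≠ b' → ∀ z, z ∈ (p a b h).support → z ∈ (p a b' h').support → z = f a)
    (hadj : ∀ a b, H.Adj a b → G.Adj (t a b) (t b a)) : ContainsSubdivision H G := by
  have hf : Function.Injective f := fun a b e => by
    by_contra hab
    exact hK a b hab _ (hfK a) (e ▸ hfK b)
  have hsupp : ∀ a b (h : H.Adj a b) z,
      z ∈ ((p a b h).append (.cons (hadj a b h) (p b a h.symm).reverse)).support ↔
        z ∈ (p a b h).support ∨ z ∈ (p b a h.symm).support := by
    intro a b h z
    rw [SimpleGraph.Walk.support_append]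
    simp
  -- The path for `ab` runs along the leg of `a`, the edge between the two tips, and back along the
  -- leg of `b`.
  refine ⟨f, hf, fun a b h => (p a b h).append (.cons (hadj a b h) (p b a h.symm).reverse),
    ?_, ?_, ?_⟩
  · intro a b h
    rw [SimpleGraph.Walk.isPath_def, SimpleGraph.Walk.support_append]
    simp only [SimpleGraph.Walk.support_cons, List.tail_cons, SimpleGraph.Walk.support_reverse]
    refine List.Nodup.append (hp a b h).support_nodup
      (List.nodup_reverse.2 (hp b a h.symm).support_nodup) ?_
    intro z hz hz'
    exact hK a b h.ne z (hpK _ _ _ z hz) (hpK _ _ _ z (List.mem_reverse.1 hz'))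
  · rintro a b h c ⟨h1, h2, h3⟩
    rw [hsupp] at h1
    rcases h1 with h1 | h1
    · have hc : c = a := by
        by_contra hca
        exact hK _ _ hca _ (hfK c) (hpK _ _ _ _ h1)
      exact h2 (by rw [hc])
    · have hc : c = b := by
        by_contra hca
        exact hK _ _ hca _ (hfK c) (hpK _ _ _ _ h1)
      exact h3 (by rw [hc])
  · have key : ∀ a b (h : H.Adj a b) c d (h' : H.Adj c d), (a, b) ≠ (c, d) → ∀ z,
        z ∈ (p a b h).support → z ∈ (p c d h').support → z = f a := by
      intro a b h c d h' hne z hz hz'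
      by_cases hac : a = c
      · subst hac
        exact hpd a b h d h' (fun e => hne (by rw [e])) z hz hz'
      · exact absurd (hpK _ _ _ _ hz') (hK a c hac z (hpK _ _ _ _ hz))
    rintro a b h c d h' hne z ⟨⟨h1, h2, h3⟩, h4, h5, h6⟩
    rw [hsupp] at h1 h4
    have n1 : (a, b) ≠ (c, d) := fun e => hne (by cases e; rfl)
    have n2 : (a, b) ≠ (d, c) := fun e => hne (by cases e; exact Sym2.eq_swap)
    have n3 : (b, a) ≠ (c, d) := fun e => hne (by cases e; exact Sym2.eq_swap)
    have n4 : (b, a) ≠ (d, c) := fun e => hne (by cases e; rfl)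
    rcases h1 with h1 | h1 <;> rcases h4 with h4 | h4
    · exact h2 (key _ _ h _ _ h' n1 z h1 h4)
    · exact h2 (key _ _ h _ _ h'.symm n2 z h1 h4)
    · exact h3 (key _ _ h.symm _ _ h' n3 z h1 h4)
    · exact h3 (key _ _ h.symm _ _ h'.symm n4 z h1 h4)

/-- A rim bag needs one leg for its spoke and two for the rim, which a tripod provides. The hub has
degree seven, which is why its bag must be a single vertex; its legs are trivial. -/
theorem IsWheelModel.containsSubdivision {V : Type*} {G : SimpleGraph V} {h : V}
    {K : Fin 7 → Set V} (hM : IsWheelModel G h K) : ContainsSubdivision (wheelGraph 7) G := by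
  have hr : ∀ k : Fin 7, ∃ x ∈ K k, ∃ y ∈ K (k + 1), G.Adj x y := fun k =>
    hM.rim k (k + 1) ((cycleGraph_seven_adj _ _).2 (Or.inl rfl))
  choose s hs hsadj using hM.spoke
  choose x hx y hy hxy using hr
  have hy' : ∀ k, y (k - 1) ∈ K k := fun k => by simpa using hy (k - 1)
  choose c hc p hp hpK hpd using fun k => (hM.conn k).exists_tripod ![s k, x k, y (k - 1)]
    (by intro i; fin_cases i <;> simp [hs, hx, hy'])
  -- Leg 0 goes to the hub, leg 1 to the next bag and leg 2 to the previous one; values at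
  -- non-neighbours do not matter.
  let idx : Fin 7 → Option (Fin 7) → Fin 3 := fun k b =>
    b.elim 0 fun l => if l = k + 1 then 1 else 2
  let t : Option (Fin 7) → Option (Fin 7) → V := fun a b =>
    a.elim h fun k => ![s k, x k, y (k - 1)] (idx k b)
  have hK' : ∀ a b : Option (Fin 7), a ≠ b → ∀ z ∈ a.elim {h} K, z ∉ b.elim {h} K := by
    rintro (_ | k) (_ | l) hab z hz hz'
    · exact hab rfl
    · exact hM.hub l ((show z = h from hz) ▸ hz')
    · exact hM.hub k ((show z = h from hz') ▸ hz)
    · exact hM.disj k l (fun e => hab (by rw [e])) z hz hz'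
  have hidx : ∀ k b b', (wheelGraph 7).Adj (some k) b → (wheelGraph 7).Adj (some k) b' → b ≠ b' →
      idx k b ≠ idx k b' := by
    rintro k (_ | l) (_ | l') hl hl' hne
    · exact absurd rfl hne
    · simp only [idx, Option.elim]; split_ifs <;> decide
    · simp only [idx, Option.elim]; split_ifs <;> decide
    · rw [wheelGraph_adj_some, cycleGraph_seven_adj] at hl hl'
      have hne' : l ≠ l' := fun e => hne (by rw [e])
      simp only [idx, Option.elim]
      revert hl hl' hne'
      revert k l l'
      decide
  refine containsSubdivision_of_legs (fun a => a.elim {h} K) hK' (fun a => a.elim h c) t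
    (fun a b _ => match a with
      | none => SimpleGraph.Walk.nil
      | some k => p k (idx k b)) ?_ ?_ ?_ ?_ ?_
  · rintro (_ | k)
    · rfl
    · exact hc k
  · rintro (_ | k) b hb
    · exact SimpleGraph.Walk.IsPath.nil
    · exact hp k _
  · rintro (_ | k) b hb z hz
    · exact List.mem_singleton.1 hz
    · exact hpK k _ z hz
  · rintro (_ | k) b hb b' hb' hne z hz hz'
    · exact List.mem_singleton.1 hz
    · exact hpd k _ _ (hidx k b b' hb hb' hne) z hz hz'
  · have hrim : ∀ k, G.Adj (t (some k) (some (k + 1))) (t (some (k + 1)) (some k)) := by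
      intro k
      have e1 : idx k (some (k + 1)) = 1 := by simp [idx]
      have e2 : idx (k + 1) (some k) = 2 := by
        have : ∀ k : Fin 7, k ≠ k + 1 + 1 := by decide
        simp [idx, this k]
      simp only [t, Option.elim, e1, e2]
      simpa using hxy k
    rintro (_ | k) (_ | l) hkl
    · exact absurd rfl hkl.ne
    · exact hsadj l
    · exact (hsadj k).symm
    · rw [wheelGraph_adj_some, cycleGraph_seven_adj] at hkl
      rcases hkl with rfl | rfl
      · exact hrim k
      · exact (hrim l).symm

theorem containsSubdivision_wheelGraph_iff {V : Type*} {G : SimpleGraph V} :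
    ContainsSubdivision (wheelGraph 7) G ↔ ∃ h K, IsWheelModel G h K :=
  ⟨IsWheelModel.of_containsSubdivision, fun ⟨_, _, h⟩ => h.containsSubdivision⟩

/-- Models of an induced subgraph become models in the ambient vertex type, so that both graphs can
be compared on `V`. -/
theorem containsSubdivision_wheelGraph_induce_iff {V : Type*} {G : SimpleGraph V} {U : Set V} :
    ContainsSubdivision (wheelGraph 7) (G.induce U) ↔
      ∃ h ∈ U, ∃ K, (∀ k, K k ⊆ U) ∧ IsWheelModel G h K := by
  rw [containsSubdivision_wheelGraph_iff]
  constructor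
  · rintro ⟨h, K, hM⟩
    refine ⟨h, h.2, fun k => Subtype.val '' K k, fun k => ?_, ?_, ?_, ?_, ?_, ?_⟩
    · rintro _ ⟨x, -, rfl⟩
      exact x.2
    · intro k
      refine (hM.conn k).map Subtype.val (fun a ha => ⟨a, ha, rfl⟩) ?_ ?_
      · exact fun a ha b hb hab => .of_adj hab ⟨a, ha, rfl⟩ ⟨b, hb, rfl⟩
      · rintro _ ⟨a, ha, rfl⟩
        exact ⟨a, ha, .refl _⟩
    · rintro k l hkl _ ⟨x, hx, rfl⟩ ⟨y, hy, e⟩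
      exact hM.disj k l hkl x hx (Subtype.ext e ▸ hy)
    · rintro k ⟨y, hy, e⟩
      exact hM.hub k (Subtype.ext e ▸ hy)
    · intro k
      obtain ⟨x, hx, hadj⟩ := hM.spoke k
      exact ⟨x, ⟨x, hx, rfl⟩, hadj⟩
    · intro k l hkl
      obtain ⟨x, hx, y, hy, hadj⟩ := hM.rim k l hkl
      exact ⟨x, ⟨x, hx, rfl⟩, y, ⟨y, hy, rfl⟩, hadj⟩
  · rintro ⟨h, hU, K, hKU, hM⟩
    refine ⟨⟨h, hU⟩, fun k => {x | x.1 ∈ K k}, ?_, ?_, ?_, ?_, ?_⟩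
    · intro k
      classical
      -- The value `h` off `U` is a dummy, since every bag lies in `U`.
      let π : V → U := fun x => if hx : x ∈ U then ⟨x, hx⟩ else ⟨h, hU⟩
      have hπ : ∀ x (hx : x ∈ U), π x = ⟨x, hx⟩ := fun x hx => dif_pos hx
      refine (hM.conn k).map π ?_ ?_ ?_
      · intro a ha
        rw [hπ a (hKU k ha)]
        exact ha
      · intro a ha b hb hab
        rw [hπ a (hKU k ha), hπ b (hKU k hb)]
        exact .of_adj hab ha hb
      · intro u hu
        refine ⟨u.1, hu, ?_⟩
        rw [hπ u.1 u.2]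
        exact .refl _
    · exact fun k l hkl x hx hx' => hM.disj k l hkl x.1 hx hx'
    · exact fun k => hM.hub k
    · intro k
      obtain ⟨x, hx, hadj⟩ := hM.spoke k
      exact ⟨⟨x, hKU k hx⟩, hx, hadj⟩
    · intro k l hkl
      obtain ⟨x, hx, y, hy, hadj⟩ := hM.rim k l hkl
      exact ⟨⟨x, hKU k hx⟩, hx, ⟨y, hKU l hy⟩, hy, hadj⟩

/-! ### The two sides of the cutset -/

/-- Deleting two vertices of a 3-connected graph leaves a connected graph. -/
theorem IsKConnected.exists_adj_avoiding {V : Type*} {G : SimpleGraph V} (hG : IsKConnected G 3)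
    (D : Set V) (p q : V) {x z : V} (hx : x ∈ D) (hp : p ∉ D) (hq : q ∉ D) (hz : z ∉ D)
    (hzp : z ≠ p) (hzq : z ≠ q) : ∃ x ∈ D, ∃ y ∉ D, y ≠ p ∧ y ≠ q ∧ G.Adj x y := by
  classical
  have hcon := hG.2 {p, q} (lt_of_le_of_lt Finset.card_le_two (by norm_num))
  obtain ⟨w⟩ := hcon.preconnected
    ⟨x, by simp only [Set.mem_ofPred, Finset.mem_insert, Finset.mem_singleton, not_or]; exact
      ⟨fun e => hp (e ▸ hx), fun e => hq (e ▸ hx)⟩⟩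
    ⟨z, by simp only [Set.mem_ofPred, Finset.mem_insert, Finset.mem_singleton, not_or]; exact
      ⟨hzp, hzq⟩⟩
  obtain ⟨a, -, ha, b, -, hb, hab⟩ := (ReachIn.of_walk w (s := Set.univ) (by simp)).exists_adj
    (T := Subtype.val ⁻¹' D) hx hz
  have hb2 := b.2
  simp only [Set.mem_ofPred, Finset.mem_insert, Finset.mem_singleton, not_or] at hb2
  exact ⟨a.1, ha, b.1, hb, hb2.1, hb2.2, hab⟩

/-- The graph `G` is split by the vertex `v` and the edges `a₁b₁` and `a₂b₂` into the connected
sides `A` and `B`, and has no separating set of two vertices. -/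
structure IsSplit {V : Type*} (G : SimpleGraph V) (A B : Set V) (v a₁ b₁ a₂ b₂ : V) : Prop where
  sep : ∀ (D : Set V) (p q x z : V), x ∈ D → p ∉ D → q ∉ D → z ∉ D → z ≠ p → z ≠ q →
    ∃ x ∈ D, ∃ y ∉ D, y ≠ p ∧ y ≠ q ∧ G.Adj x y
  cover : ∀ x, x ∈ A ∨ x ∈ B ∨ x = v
  disj : ∀ x ∈ A, x ∉ B
  v_A : v ∉ A
  v_B : v ∉ B
  a₁_mem : a₁ ∈ A
  a₂_mem : a₂ ∈ A
  b₁_mem : b₁ ∈ B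
  b₂_mem : b₂ ∈ B
  a_ne : a₁ ≠ a₂
  b_ne : b₁ ≠ b₂
  adj₁ : G.Adj a₁ b₁
  adj₂ : G.Adj a₂ b₂
  cross : ∀ x ∈ A, ∀ y ∈ B, G.Adj x y → (x = a₁ ∧ y = b₁) ∨ (x = a₂ ∧ y = b₂)
  conn_A : ConnOn G A
  conn_B : ConnOn G B

theorem IsSplit.symm {V : Type*} {G : SimpleGraph V} {A B : Set V} {v a₁ b₁ a₂ b₂ : V}
    (S : IsSplit G A B v a₁ b₁ a₂ b₂) : IsSplit G B A v b₁ a₁ b₂ a₂ where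
  sep := S.sep
  cover x := by rcases S.cover x with h | h | h <;> simp [h]
  disj x hB hA := S.disj x hA hB
  v_A := S.v_B
  v_B := S.v_A
  a₁_mem := S.b₁_mem
  a₂_mem := S.b₂_mem
  b₁_mem := S.a₁_mem
  b₂_mem := S.a₂_mem
  a_ne := S.b_ne
  b_ne := S.a_ne
  adj₁ := S.adj₁.symm
  adj₂ := S.adj₂.symm
  cross x hx y hy h := (S.cross y hy x hx h.symm).imp And.symm And.symm
  conn_A := S.conn_B
  conn_B := S.conn_A

/-! ### The components left by the cutset -/

section Components

variable {V : Type*} {G : SimpleGraph V} {e₁ e₂ : Sym2 V} {v : V}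

theorem mem_componentVerts {C : (edgeVertexRemoval G e₁ e₂ v).ConnectedComponent} {x : V} :
    x ∈ componentVerts C ↔
      ∃ h : x ≠ v, (edgeVertexRemoval G e₁ e₂ v).connectedComponentMk ⟨x, h⟩ = C := by
  constructor
  · rintro ⟨y, hy, rfl⟩
    exact ⟨y.2, hy⟩
  · rintro ⟨h, hC⟩
    exact ⟨⟨x, h⟩, hC, rfl⟩

theorem componentVerts_disjoint {C D : (edgeVertexRemoval G e₁ e₂ v).ConnectedComponent}
    (h : C ≠ D) {x : V} (hx : x ∈ componentVerts C) : x ∉ componentVerts D := by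
  intro hx'
  obtain ⟨h1, rfl⟩ := mem_componentVerts.1 hx
  obtain ⟨h2, rfl⟩ := mem_componentVerts.1 hx'
  exact h rfl

theorem edge_of_leaves_componentVerts {C : (edgeVertexRemoval G e₁ e₂ v).ConnectedComponent}
    {x y : V} (hx : x ∈ componentVerts C) (hy : y ∉ componentVerts C) (hyv : y ≠ v)
    (hxy : G.Adj x y) : s(x, y) = e₁ ∨ s(x, y) = e₂ := by
  by_contra hcon
  obtain ⟨h1, rfl⟩ := mem_componentVerts.1 hx
  refine hy (mem_componentVerts.2 ⟨hyv, ?_⟩)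
  refine SimpleGraph.ConnectedComponent.sound (SimpleGraph.Adj.reachable ?_)
  simp only [edgeVertexRemoval, SimpleGraph.comap_adj, SimpleGraph.deleteEdges_adj,
    Function.Embedding.subtype_apply, SimpleGraph.induce]
  refine ⟨hxy.symm, ?_⟩
  simpa [Sym2.eq_swap (a := y)] using hcon

theorem connOn_componentVerts (C : (edgeVertexRemoval G e₁ e₂ v).ConnectedComponent) :
    ConnOn G (componentVerts C) := by
  obtain ⟨x, rfl⟩ := C.exists_rep
  refine ConnOn.of_root (x := x.1) (mem_componentVerts.2 ⟨x.2, rfl⟩) fun y hy => ?_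
  obtain ⟨h, hC⟩ := mem_componentVerts.1 hy
  obtain ⟨w⟩ := SimpleGraph.ConnectedComponent.exact hC.symm
  have h1 : ReachIn (edgeVertexRemoval G e₁ e₂ v)
      {z | (edgeVertexRemoval G e₁ e₂ v).connectedComponentMk z = Quot.mk _ x} x ⟨y, h⟩ := by
    refine ReachIn.of_walk w fun z hz => ?_
    classical
    exact (SimpleGraph.ConnectedComponent.sound (w.takeUntil z hz).reachable).symm
  refine ReachIn.map (F := G) Subtype.val (fun a ha b hb hab => ?_) h1
  refine .of_adj ?_ (mem_componentVerts.2 ⟨a.2, ha⟩) (mem_componentVerts.2 ⟨b.2, hb⟩)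
  simp only [edgeVertexRemoval, SimpleGraph.comap_adj, SimpleGraph.deleteEdges_adj,
    Function.Embedding.subtype_apply, SimpleGraph.induce] at hab
  exact hab.1

theorem ncard_componentVerts (hS : IsType1EdgeVertexCutset G e₁ e₂ v)
    (C : (edgeVertexRemoval G e₁ e₂ v).ConnectedComponent) : 4 ≤ (componentVerts C).ncard := by
  rw [componentVerts, Set.ncard_image_of_injective _ Subtype.val_injective]
  exact hS.2.2.2.2 C

theorem exists_mem_ne_ne {s : Set V} (hs : 4 ≤ s.ncard) (p q : V) : ∃ x ∈ s, x ≠ p ∧ x ≠ q := by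
  classical
  by_contra! hcon
  have hsub : s ⊆ (({p, q} : Finset V) : Set V) := by
    intro x hx
    by_cases hxp : x = p
    · simp [hxp]
    · simp [hcon x hx hxp]
  have h1 := Set.ncard_le_ncard hsub (Finset.finite_toSet _)
  rw [Set.ncard_coe_finset] at h1
  have := Finset.card_le_two (a := p) (b := q)
  omega

/-- Every component of `G - {e₁, e₂, v}` has an edge other than `e` that leaves it. -/
theorem exists_leaving_edge_ne (hG : IsKConnected G 3) (hS : IsType1EdgeVertexCutset G e₁ e₂ v)
    {C D : (edgeVertexRemoval G e₁ e₂ v).ConnectedComponent} (hCD : C ≠ D) (e : Sym2 V) :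
    ∃ x ∈ componentVerts C, ∃ y ∉ componentVerts C, y ≠ v ∧ G.Adj x y ∧ s(x, y) ≠ e := by
  have hv : v ∉ componentVerts C := fun h => (mem_componentVerts.1 h).1 rfl
  obtain ⟨x₀, hx₀, -, -⟩ := exists_mem_ne_ne (ncard_componentVerts hS C) v v
  obtain ⟨z₀, hz₀, hz₀v, -⟩ := exists_mem_ne_ne (ncard_componentVerts hS D) v v
  have hz₀C := componentVerts_disjoint hCD.symm hz₀
  -- Since `v` alone does not separate, some edge `pq` leaves `C`. If `e` were the only such edge,
  -- then `p` and `v` would separate the rest of `C` from `D`.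
  obtain ⟨p, hp, q, hq, hqv, -, hpq⟩ :=
    hG.exists_adj_avoiding _ v v hx₀ hv hv hz₀C hz₀v hz₀v
  by_contra! hcon
  have hpe := hcon p hp q hq hqv hpq
  obtain ⟨x₁, hx₁, hx₁p, -⟩ := exists_mem_ne_ne (ncard_componentVerts hS C) p p
  obtain ⟨x, hx, y, hy, hyp, hyv, hxy⟩ := hG.exists_adj_avoiding (componentVerts C \ {p}) p v
    (x := x₁) (z := z₀) ⟨hx₁, hx₁p⟩ (by simp) (fun h => hv h.1) (fun h => hz₀C h.1)
    (fun h => hz₀C (h ▸ hp)) hz₀v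
  have hyC : y ∉ componentVerts C := fun h => hy ⟨h, hyp⟩
  have he := hcon x hx.1 y hyC hyv hxy
  rw [← hpe, Sym2.eq_iff] at he
  rcases he with ⟨h, -⟩ | ⟨h, -⟩
  · exact hx.2 h
  · exact hq (h ▸ hx.1)

/-- Both edges of the cutset leave every component. -/
theorem exists_ends (hG : IsKConnected G 3) (hS : IsType1EdgeVertexCutset G e₁ e₂ v)
    {C D : (edgeVertexRemoval G e₁ e₂ v).ConnectedComponent} (hCD : C ≠ D) :
    (∃ x ∈ componentVerts C, ∃ y ∉ componentVerts C, s(x, y) = e₁) ∧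
      ∃ x ∈ componentVerts C, ∃ y ∉ componentVerts C, s(x, y) = e₂ := by
  constructor
  · obtain ⟨x, hx, y, hy, hyv, hxy, hne⟩ := exists_leaving_edge_ne hG hS hCD e₂
    exact ⟨x, hx, y, hy, (edge_of_leaves_componentVerts hx hy hyv hxy).resolve_right hne⟩
  · obtain ⟨x, hx, y, hy, hyv, hxy, hne⟩ := exists_leaving_edge_ne hG hS hCD e₁
    exact ⟨x, hx, y, hy, (edge_of_leaves_componentVerts hx hy hyv hxy).resolve_left hne⟩

/-- If the two edges had the same end in `C`, this end and `v` would separate the other vertices of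
`C` from `D`. -/
theorem end_ne_of_componentVerts (hG : IsKConnected G 3) (hS : IsType1EdgeVertexCutset G e₁ e₂ v)
    {C D : (edgeVertexRemoval G e₁ e₂ v).ConnectedComponent} (hCD : C ≠ D) {a₁ b₁ a₂ b₂ : V}
    (ha₁ : a₁ ∈ componentVerts C) (hb₁ : b₁ ∉ componentVerts C)
    (hb₂ : b₂ ∉ componentVerts C) (h₁ : s(a₁, b₁) = e₁) (h₂ : s(a₂, b₂) = e₂) : a₁ ≠ a₂ := by
  rintro rfl
  have hv : v ∉ componentVerts C := fun h => (mem_componentVerts.1 h).1 rfl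
  obtain ⟨z₀, hz₀, hz₀v, -⟩ := exists_mem_ne_ne (ncard_componentVerts hS D) v v
  have hz₀C := componentVerts_disjoint hCD.symm hz₀
  obtain ⟨x₁, hx₁, hx₁p, -⟩ := exists_mem_ne_ne (ncard_componentVerts hS C) a₁ a₁
  obtain ⟨x, hx, y, hy, hyp, hyv, hxy⟩ := hG.exists_adj_avoiding (componentVerts C \ {a₁}) a₁ v
    (x := x₁) (z := z₀) ⟨hx₁, hx₁p⟩ (by simp) (fun h => hv h.1) (fun h => hz₀C h.1)
    (fun h => hz₀C (h ▸ ha₁)) hz₀v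
  have hyC : y ∉ componentVerts C := fun h => hy ⟨h, hyp⟩
  rcases edge_of_leaves_componentVerts hx.1 hyC hyv hxy with he | he
  · rw [← h₁, Sym2.eq_iff] at he
    rcases he with ⟨h, -⟩ | ⟨h, -⟩
    · exact hx.2 h
    · exact hb₁ (h ▸ hx.1)
  · rw [← h₂, Sym2.eq_iff] at he
    rcases he with ⟨h, -⟩ | ⟨h, -⟩
    · exact hx.2 h
    · exact hb₂ (h ▸ hx.1)

/-- Both cut edges leave every component, and an edge has only two ends; hence each edge joins `C`
to `D` and no third component exists. -/
theorem exists_isSplit (hG : IsKConnected G 3) (hS : IsType1EdgeVertexCutset G e₁ e₂ v)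
    {C D : (edgeVertexRemoval G e₁ e₂ v).ConnectedComponent} (hCD : C ≠ D) :
    ∃ a₁ b₁ a₂ b₂, s(a₁, b₁) = e₁ ∧ s(a₂, b₂) = e₂ ∧
      IsSplit G (componentVerts C) (componentVerts D) v a₁ b₁ a₂ b₂ := by
  have key : ∀ {e : Sym2 V} {C D : (edgeVertexRemoval G e₁ e₂ v).ConnectedComponent}, C ≠ D →
      (∃ x ∈ componentVerts C, ∃ y ∉ componentVerts C, s(x, y) = e) →
      (∃ x ∈ componentVerts D, ∃ y ∉ componentVerts D, s(x, y) = e) →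
      ∃ x ∈ componentVerts C, ∃ y ∈ componentVerts D, s(x, y) = e := by
    rintro e C D hCD ⟨x, hx, y, hy, rfl⟩ ⟨z, hz, w, hw, he⟩
    refine ⟨x, hx, y, ?_, rfl⟩
    rcases Sym2.eq_iff.1 he with ⟨rfl, rfl⟩ | ⟨rfl, rfl⟩
    · exact absurd hz (componentVerts_disjoint hCD hx)
    · exact hz
  obtain ⟨C1, C2⟩ := exists_ends hG hS hCD
  obtain ⟨D1, D2⟩ := exists_ends hG hS hCD.symm
  obtain ⟨a₁, ha₁, b₁, hb₁, h₁⟩ := key hCD C1 D1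
  obtain ⟨a₂, ha₂, b₂, hb₂, h₂⟩ := key hCD C2 D2
  have hb₁' := componentVerts_disjoint hCD.symm hb₁
  have hb₂' := componentVerts_disjoint hCD.symm hb₂
  have ha₁' := componentVerts_disjoint hCD ha₁
  have ha₂' := componentVerts_disjoint hCD ha₂
  refine ⟨a₁, b₁, a₂, b₂, h₁, h₂, ?_⟩
  refine ⟨fun D p q x z hx hp hq hz hzp hzq =>
      hG.exists_adj_avoiding D p q hx hp hq hz hzp hzq, ?_,
    fun x hx => componentVerts_disjoint hCD hx, fun h => (mem_componentVerts.1 h).1 rfl,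
    fun h => (mem_componentVerts.1 h).1 rfl, ha₁, ha₂, hb₁, hb₂,
    end_ne_of_componentVerts hG hS hCD ha₁ hb₁' hb₂' h₁ h₂,
    end_ne_of_componentVerts hG hS hCD.symm hb₁ ha₁' ha₂'
      (Sym2.eq_swap.trans h₁) (Sym2.eq_swap.trans h₂),
    ?_, ?_, ?_, connOn_componentVerts C, connOn_componentVerts D⟩
  · intro x
    by_contra! hcon
    obtain ⟨hxC, hxD, hxv⟩ := hcon
    -- A third component `E` would contain an end of `e₁`, but these ends lie in `C` and `D`.
    let E := (edgeVertexRemoval G e₁ e₂ v).connectedComponentMk ⟨x, hxv⟩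
    have hxE : x ∈ componentVerts E := mem_componentVerts.2 ⟨hxv, rfl⟩
    have hEC : E ≠ C := fun h => hxC (h ▸ hxE)
    have hED : E ≠ D := fun h => hxD (h ▸ hxE)
    obtain ⟨⟨p, hp, q, -, hpq⟩, -⟩ := exists_ends hG hS hEC
    rw [← h₁, Sym2.eq_iff] at hpq
    rcases hpq with ⟨rfl, -⟩ | ⟨rfl, -⟩
    · exact componentVerts_disjoint hEC hp ha₁
    · exact componentVerts_disjoint hED hp hb₁
  · have := hS.1
    rwa [← h₁] at this
  · have := hS.2.1
    rwa [← h₂] at this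
  · intro x hx y hy hxy
    have hyv : y ≠ v := (mem_componentVerts.1 hy).1
    rcases edge_of_leaves_componentVerts hx (componentVerts_disjoint hCD.symm hy) hyv hxy with
      he | he
    · rw [← h₁, Sym2.eq_iff] at he
      rcases he with h | ⟨rfl, rfl⟩
      · exact Or.inl h
      · exact absurd hb₁ (componentVerts_disjoint hCD hx)
    · rw [← h₂, Sym2.eq_iff] at he
      rcases he with h | ⟨rfl, rfl⟩
      · exact Or.inr h
      · exact absurd hb₂ (componentVerts_disjoint hCD hx)

/-- Otherwise `a₁` and `a₂` would separate the remaining vertices of `C`, of which there are at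
least two, from `v`. Hence the new path is never empty. -/
theorem exists_neighbor_mem_componentVerts (hG : IsKConnected G 3)
    (hS : IsType1EdgeVertexCutset G e₁ e₂ v)
    {C D : (edgeVertexRemoval G e₁ e₂ v).ConnectedComponent} (hCD : C ≠ D) :
    ∃ x ∈ componentVerts C, G.Adj v x := by
  obtain ⟨a₁, b₁, a₂, b₂, -, -, S⟩ := exists_isSplit hG hS hCD
  obtain ⟨x₀, hx₀, h1, h2⟩ := exists_mem_ne_ne (ncard_componentVerts hS C) a₁ a₂
  obtain ⟨x, hx, y, hy, hy1, hy2, hxy⟩ := S.sep (componentVerts C \ {a₁, a₂}) a₁ a₂ x₀ v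
    ⟨hx₀, by simp [h1, h2]⟩ (by simp) (by simp) (fun h => S.v_A h.1)
    (fun h => S.v_A (h ▸ S.a₁_mem)) (fun h => S.v_A (h ▸ S.a₂_mem))
  have hxa : x ≠ a₁ ∧ x ≠ a₂ := by simpa using hx.2
  rcases S.cover y with h | h | rfl
  · exact absurd ⟨h, by simp [hy1, hy2]⟩ hy
  · rcases S.cross x hx.1 y h hxy with h | h
    · exact absurd h.1 hxa.1
    · exact absurd h.1 hxa.2
  · exact ⟨x, hx.1, hxy.symm⟩

end Components

/-! ### An `st`-numbering of a side -/

section Numbering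

variable {V : Type*} {G : SimpleGraph V} {A B : Set V} {v a₁ b₁ a₂ b₂ : V}

/-- In a connected part `D` of `B` that contains `b₂` but not `b₁`, some vertex other than `b₂`
with a neighbour in `B \ D` can be deleted without disconnecting `D`. -/
theorem IsSplit.exists_peel [Finite V] (S : IsSplit G A B v a₁ b₁ a₂ b₂) {D : Set V} (hDB : D ⊆ B)
    (hb₂ : b₂ ∈ D) (hb₁ : b₁ ∉ D) (hD : ConnOn G D) {d : V} (hd : d ∈ D) (hdb : d ≠ b₂) :
    ∃ x ∈ D, x ≠ b₂ ∧ (∃ y ∈ B, y ∉ D ∧ G.Adj x y) ∧ ConnOn G (D \ {x}) := by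
  let T : Set V := {x | x ∈ D ∧ x ≠ b₂ ∧ ∃ y ∈ B, y ∉ D ∧ G.Adj x y}
  -- `c x` is the component of `b₂` in `D - x`.
  let c : V → Set V := fun x => {z | z ∈ D \ {x} ∧ ReachIn G (D \ {x}) b₂ z}
  have hvD : v ∉ D := fun h => S.v_B (hDB h)
  have hTne : T.Nonempty := by
    obtain ⟨x, hx, y, hy, hy2, hyv, hxy⟩ := S.sep (D \ {b₂}) b₂ v d b₁ ⟨hd, hdb⟩ (by simp)
      (fun h => hvD h.1) (fun h => hb₁ h.1) S.b_ne (fun h => S.v_B (h ▸ S.b₁_mem))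
    have hyD : y ∉ D := fun h => hy ⟨h, hy2⟩
    rcases S.cover y with h | h | h
    · rcases S.cross y h x (hDB hx.1) hxy.symm with h | h
      · exact absurd (h.2 ▸ hx.1) hb₁
      · exact absurd h.2 hx.2
    · exact ⟨x, hx.1, hx.2, y, h, hyD, hxy⟩
    · exact absurd h hyv
  -- The candidate `x` is chosen to make the component of `b₂` in `D - x` as large as possible.
  obtain ⟨x, hxT, hmax⟩ := Set.exists_max_image T (fun x => (c x).ncard) (Set.toFinite T) hTne
  refine ⟨x, hxT.1, hxT.2.1, hxT.2.2, ?_⟩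
  have hb₂c : ∀ x ∈ T, b₂ ∈ c x := fun x hx => ⟨⟨hb₂, fun h => hx.2.1 h.symm⟩, .refl _⟩
  have hcx : ∀ p ∈ D, p ∉ c x → ∀ z ∈ c x, ReachIn G (c x) b₂ z := by
    rintro p hp hpc z ⟨hz, hreach⟩
    induction hreach with
    | refl => exact .refl _
    | @tail u w hu h ih =>
      have huc : u ∈ c x := ⟨h.2.1, hu⟩
      exact (ih h.2.1).trans (.of_adj h.1 huc ⟨hz, hu.tail h⟩)
  by_contra hcon
  have hZ : ∃ z ∈ D \ {x}, z ∉ c x := by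
    by_contra! h
    exact hcon (.of_root ⟨hb₂, fun h => hxT.2.1 h.symm⟩ fun y hy => (h y hy).2)
  obtain ⟨z, hz, hzc⟩ := hZ
  -- The part of `D - x` cut off from `b₂` is not separated by `x` and `v`, so it contains a vertex
  -- `p` with a neighbour in `B \ D`, which is again a candidate.
  obtain ⟨p, hp, q, hq, hqx, hqv, hpq⟩ := S.sep ((D \ {x}) \ c x) x v z b₂ ⟨hz, hzc⟩
    (fun h => h.1.2 rfl) (fun h => hvD h.1.1) (fun h => h.2 (hb₂c x hxT))
    (fun h => hxT.2.1 h.symm) (fun h => S.v_B (h ▸ S.b₂_mem))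
  have hpb₂ : p ≠ b₂ := fun h => hp.2 (h ▸ hb₂c x hxT)
  have hpT : p ∈ T := by
    refine ⟨hp.1.1, hpb₂, ?_⟩
    by_cases hqD : q ∈ D
    · have hqc : q ∈ c x := by
        by_contra h
        exact hq ⟨⟨hqD, hqx⟩, h⟩
      exact absurd ⟨hp.1, hqc.2.trans (.of_adj hpq.symm hqc.1 hp.1)⟩ hp.2
    · rcases S.cover q with h | h | h
      · rcases S.cross q h p (hDB hp.1.1) hpq.symm with h | h
        · exact absurd (h.2 ▸ hp.1.1) hb₁
        · exact absurd h.2 hpb₂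
      · exact ⟨q, h, hqD, hpq⟩
      · exact absurd h hqv
  have hsub : c x ⊆ c p := by
    intro u hu
    have huD : ∀ u ∈ c x, u ∈ D \ {p} := fun u hu => ⟨hu.1.1, fun h => hp.2 (h ▸ hu)⟩
    exact ⟨huD u hu, (hcx p hp.1.1 hp.2 u hu).mono huD⟩
  -- Deleting `p` leaves `c x` intact and attached to `x`, so `c p` is strictly larger, against the
  -- choice of `x`.
  obtain ⟨u, -, huc, w, hw, hwc, huw⟩ := hD.exists_adj (T := c x) hb₂ (hb₂c x hxT) hz.1 hzc
  have hwx : w = x := by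
    by_contra hwx
    exact hwc ⟨⟨hw, hwx⟩, huc.2.trans (.of_adj huw huc.1 ⟨hw, hwx⟩)⟩
  subst hwx
  have hwp : w ∈ c p := by
    have hwD : w ∈ D \ {p} := ⟨hw, fun h => hp.1.2 h.symm⟩
    exact ⟨hwD, (hsub huc).2.trans (.of_adj huw (hsub huc).1 hwD)⟩
  have hlt : (c w).ncard < (c p).ncard :=
    Set.ncard_lt_ncard ⟨hsub, fun h => (h hwp).1.2 rfl⟩ (Set.toFinite _)
  exact absurd (hmax p hpT) (by simpa using hlt)

/-- Vertices are peeled off one at a time; the peeled vertex gets label 0 and the other labels move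
up. A neighbour in `B \ D` may replace a smaller neighbour, because vertices outside `D` end up with
smaller labels than those of `D`. -/
theorem IsSplit.exists_numbering_aux [Finite V] (S : IsSplit G A B v a₁ b₁ a₂ b₂) (n : ℕ) :
    ∀ D : Set V, D.ncard = n → D ⊆ B → b₂ ∈ D → b₁ ∉ D → ConnOn G D →
      ∃ f : V → ℕ, Set.InjOn f D ∧ (∀ x ∈ D, x ≠ b₂ → ∃ y ∈ D, G.Adj x y ∧ f x < f y) ∧
        ∀ x ∈ D, (∃ y ∈ D, G.Adj x y ∧ f y < f x) ∨ ∃ y ∈ B, y ∉ D ∧ G.Adj x y := by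
  classical
  induction n with
  | zero =>
    intro D hD _ hb₂
    rw [Set.ncard_eq_zero] at hD
    simp [hD] at hb₂
  | succ n ih =>
    intro D hcard hDB hb₂ hb₁ hD
    by_cases hd : ∃ d ∈ D, d ≠ b₂
    · obtain ⟨d, hd, hdb⟩ := hd
      obtain ⟨x, hx, hxb, ⟨y₀, hy₀, hy₀D, hadj₀⟩, hconn⟩ := S.exists_peel hDB hb₂ hb₁ hD hd hdb
      obtain ⟨f, hinj, hup, hdown⟩ := ih (D \ {x})
        (by rw [Set.ncard_sdiff_singleton_of_mem hx, hcard]; rfl)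
        (fun y hy => hDB hy.1) ⟨hb₂, fun h => hxb h.symm⟩ (fun h => hb₁ h.1) hconn
      have hne : ∀ y ∈ D, y ≠ x → y ∈ D \ {x} := fun y hy h => ⟨hy, h⟩
      refine ⟨fun y => if y = x then 0 else f y + 1, ?_, ?_, ?_⟩
      · intro y hy z hz hyz
        simp only at hyz
        split_ifs at hyz with h1 h2 h2
        · rw [h1, h2]
        · exact hinj (hne y hy h1) (hne z hz h2) (by omega)
      · intro y hy hyb
        by_cases hyx : y = x
        · subst hyx
          obtain ⟨p, hp, hpy, q, hq, hqy, hpq⟩ := hD.exists_adj (T := {y}) hy rfl hb₂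
            (fun h => hyb h.symm)
          obtain rfl : p = y := hpy
          exact ⟨q, hq, hpq, by simp [show q ≠ p from hqy]⟩
        · obtain ⟨z, hz, hyz, hlt⟩ := hup y (hne y hy hyx) hyb
          have hzx : z ≠ x := hz.2
          exact ⟨z, hz.1, hyz, by simpa [hyx, hzx] using hlt⟩
      · intro y hy
        by_cases hyx : y = x
        · subst hyx
          exact Or.inr ⟨y₀, hy₀, hy₀D, hadj₀⟩
        · rcases hdown y (hne y hy hyx) with ⟨z, hz, hyz, hlt⟩ | ⟨z, hz, hzD, hyz⟩
          · have hzx : z ≠ x := hz.2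
            exact Or.inl ⟨z, hz.1, hyz, by simpa [hyx, hzx] using hlt⟩
          -- The promised neighbour outside the smaller set may be the peeled vertex itself, which
          -- now has the smallest label.
          · by_cases hzx : z = x
            · subst hzx
              exact Or.inl ⟨z, hx, hyz, by simp [hyx]⟩
            · exact Or.inr ⟨z, hz, fun h => hzD ⟨h, hzx⟩, hyz⟩
    · push Not at hd
      refine ⟨fun _ => 0, fun x hx y hy _ => (hd x hx).trans (hd y hy).symm,
        fun x hx h => absurd (hd x hx) h, fun x hx => Or.inr ?_⟩
      obtain ⟨p, hp, hpb, q, hq, hqb, hpq⟩ := S.conn_B.exists_adj (T := {b₂}) S.b₂_mem rfl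
        S.b₁_mem S.b_ne
      obtain rfl := hd x hx
      obtain rfl : p = x := hpb
      exact ⟨q, hq, fun h => hqb (hd q h), hpq⟩

/-- The side `B` has an `st`-numbering from `b₁` to `b₂`. -/
theorem IsSplit.exists_numbering [Finite V] (S : IsSplit G A B v a₁ b₁ a₂ b₂) :
    ∃ f : V → ℕ, Set.InjOn f B ∧ (∀ x ∈ B, x ≠ b₂ → ∃ y ∈ B, G.Adj x y ∧ f x < f y) ∧
      ∀ x ∈ B, x ≠ b₁ → ∃ y ∈ B, G.Adj x y ∧ f y < f x := by
  classical
  have hb₂ : b₂ ∈ B \ {b₁} := ⟨S.b₂_mem, fun h => S.b_ne h.symm⟩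
  -- A part of `B - b₁` not reached from `b₂` would be separated by `b₁` and `v`.
  have hconn : ConnOn G (B \ {b₁}) := by
    by_contra hcon
    have hZ : ∃ z ∈ B \ {b₁}, ¬ ReachIn G (B \ {b₁}) b₂ z := by
      by_contra! h
      exact hcon (.of_root hb₂ h)
    obtain ⟨z, hz, hzr⟩ := hZ
    obtain ⟨p, ⟨hp, hpr⟩, q, hq, hqb, hqv, hpq⟩ :=
      S.sep {z | z ∈ B \ {b₁} ∧ ¬ ReachIn G (B \ {b₁}) b₂ z} b₁ v z b₂ ⟨hz, hzr⟩
        (fun h => h.1.2 rfl) (fun h => S.v_B h.1.1) (fun h => h.2 (.refl _)) hb₂.2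
        (fun h => S.v_B (h ▸ S.b₂_mem))
    rcases S.cover q with h | h | h
    · rcases S.cross q h p hp.1 hpq.symm with h | h
      · exact hp.2 h.2
      · exact hpr (h.2 ▸ .refl _)
    · have hq' : q ∈ B \ {b₁} := ⟨h, hqb⟩
      have hqr : ReachIn G (B \ {b₁}) b₂ q := by
        by_contra hc
        exact hq ⟨hq', hc⟩
      exact hpr (hqr.trans (.of_adj hpq.symm hq' hp))
    · exact hqv h
  obtain ⟨f, hinj, hup, hdown⟩ := S.exists_numbering_aux _ _ rfl Set.sdiff_subset hb₂
    (fun h => h.2 rfl) hconn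
  have hne : ∀ y ∈ B, y ≠ b₁ → y ∈ B \ {b₁} := fun y hy h => ⟨hy, h⟩
  -- `b₁` receives the smallest label, and a neighbour in `B` outside `B \ {b₁}` can only be `b₁`.
  refine ⟨fun y => if y = b₁ then 0 else f y + 1, ?_, ?_, ?_⟩
  · intro y hy z hz hyz
    simp only at hyz
    split_ifs at hyz with h1 h2 h2
    · rw [h1, h2]
    · exact hinj (hne y hy h1) (hne z hz h2) (by omega)
  · intro y hy hyb
    by_cases hyx : y = b₁
    · subst hyx
      obtain ⟨p, hp, hpy, q, hq, hqy, hpq⟩ := S.conn_B.exists_adj (T := {y}) hy rfl S.b₂_mem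
        (fun h => hyb h.symm)
      obtain rfl : p = y := hpy
      exact ⟨q, hq, hpq, by simp [show q ≠ p from hqy]⟩
    · obtain ⟨z, hz, hyz, hlt⟩ := hup y (hne y hy hyx) hyb
      have hzx : z ≠ b₁ := hz.2
      exact ⟨z, hz.1, hyz, by simpa [hyx, hzx] using hlt⟩
  · intro y hy hyb
    rcases hdown y (hne y hy hyb) with ⟨z, hz, hyz, hlt⟩ | ⟨z, hz, hzD, hyz⟩
    · have hzx : z ≠ b₁ := hz.2
      exact ⟨z, hz.1, hyz, by simpa [hyb, hzx] using hlt⟩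
    · have hzx : z = b₁ := by
        by_contra h
        exact hzD ⟨hz, h⟩
      exact ⟨z, hz, hyz, by simp [hyb, hzx]⟩

/-! ### Cutting a numbered side into connected bags -/

/-- A vertex whose `f`-decreasing walks stay in `s` reaches the root. -/
theorem reachIn_root_of_descending {s : Set V} {b : V} (f : V → ℕ)
    (h : ∀ x ∈ s, x ≠ b → ∃ y ∈ s, G.Adj x y ∧ f y < f x) (n : ℕ) :
    ∀ x ∈ s, f x = n → ReachIn G s b x := by
  induction n using Nat.strong_induction_on with
  | _ n ih =>
    intro x hx hn
    by_cases hxb : x = b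
    · subst hxb; exact .refl _
    · obtain ⟨y, hy, hxy, hlt⟩ := h x hx hxb
      exact (ih (f y) (hn ▸ hlt) y hy rfl).trans (.of_adj hxy.symm hy hx)

theorem connOn_of_descending {s : Set V} {b : V} (hb : b ∈ s) (f : V → ℕ)
    (h : ∀ x ∈ s, x ≠ b → ∃ y ∈ s, G.Adj x y ∧ f y < f x) : ConnOn G s :=
  .of_root hb fun x hx => reachIn_root_of_descending f h _ x hx rfl

theorem connOn_of_ascending [Finite V] {s : Set V} {b : V} (hb : b ∈ s) (f : V → ℕ)
    (h : ∀ x ∈ s, x ≠ b → ∃ y ∈ s, G.Adj x y ∧ f x < f y) : ConnOn G s := by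
  obtain ⟨N, hN⟩ := (Set.finite_range f).bddAbove
  have hN' : ∀ x, f x ≤ N := fun x => hN ⟨x, rfl⟩
  -- Reversing the labels below the bound `N` turns ascents into descents.
  refine connOn_of_descending hb (fun x => N - f x) fun x hx hxb => ?_
  obtain ⟨y, hy, hxy, hlt⟩ := h x hx hxb
  have := hN' y
  exact ⟨y, hy, hxy, by omega⟩

theorem min_of_descending [Finite V] {s : Set V} {b : V} (f : V → ℕ)
    (h : ∀ x ∈ s, x ≠ b → ∃ y ∈ s, G.Adj x y ∧ f y < f x) : ∀ x ∈ s, f b ≤ f x := by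
  intro x hx
  obtain ⟨m, hm, hmin⟩ := Set.exists_min_image s f (Set.toFinite _) ⟨x, hx⟩
  by_cases hmb : m = b
  · exact hmb ▸ hmin x hx
  · obtain ⟨y, hy, -, h⟩ := h m hm hmb
    exact absurd (hmin y hy) (by omega)

theorem max_of_ascending [Finite V] {s : Set V} {b : V} (f : V → ℕ)
    (h : ∀ x ∈ s, x ≠ b → ∃ y ∈ s, G.Adj x y ∧ f x < f y) : ∀ x ∈ s, f x ≤ f b := by
  intro x hx
  obtain ⟨m, hm, hmax⟩ := Set.exists_max_image s f (Set.toFinite _) ⟨x, hx⟩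
  by_cases hmb : m = b
  · exact hmb ▸ hmax x hx
  · obtain ⟨y, hy, -, h⟩ := h m hm hmb
    exact absurd (hmax y hy) (by omega)

/-- Disjoint connected sets `D 0, …, D (r - 1)` in `B`, consecutive ones joined by an edge, all
containing a neighbour of `v`, the first one containing `b₁` and the last one `b₂`. -/
structure IsBagChain (G : SimpleGraph V) (B : Set V) (v b₁ b₂ : V) (r : ℕ) (D : ℕ → Set V) :
    Prop where
  sub : ∀ k < r, D k ⊆ B
  conn : ∀ k < r, ConnOn G (D k)
  disj : ∀ k < r, ∀ l < r, k ≠ l → ∀ x ∈ D k, x ∉ D l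
  nbr : ∀ k < r, ∃ x ∈ D k, G.Adj v x
  step : ∀ k, k + 1 < r → ∃ x ∈ D k, ∃ y ∈ D (k + 1), G.Adj x y
  first : b₁ ∈ D 0
  last : b₂ ∈ D (r - 1)

theorem IsSplit.exists_isBagChain_one (S : IsSplit G A B v a₁ b₁ a₂ b₂) {w : V} (hw : w ∈ B)
    (hvw : G.Adj v w) : IsBagChain G B v b₁ b₂ 1 fun _ => B where
  sub _ _ := subset_rfl
  conn _ _ := S.conn_B
  disj k hk l hl hkl := by omega
  nbr _ _ := ⟨w, hw, hvw⟩
  step k hk := by omega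
  first := S.b₁_mem
  last := S.b₂_mem

/-- Initial segments of the numbering are connected through `b₁` and final segments through `b₂`; a
cut just below the higher neighbour of `v` gives both bags. -/
theorem IsSplit.exists_isBagChain_two [Finite V] (S : IsSplit G A B v a₁ b₁ a₂ b₂) {w₁ w₂ : V}
    (hw₁ : w₁ ∈ B) (hw₂ : w₂ ∈ B) (hv₁ : G.Adj v w₁) (hv₂ : G.Adj v w₂) (hne : w₁ ≠ w₂) :
    ∃ D, IsBagChain G B v b₁ b₂ 2 D := by
  obtain ⟨f, hinj, hup, hdown⟩ := S.exists_numbering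
  -- The bags need not match particular neighbours of `v`, so these may be sorted by label; the
  -- order in which they are listed is irrelevant.
  wlog hlt : f w₁ < f w₂ generalizing w₁ w₂
  · have h := hinj.ne hw₁ hw₂ hne
    exact this hw₂ hw₁ hv₂ hv₁ hne.symm (by omega)
  have hmin := min_of_descending f hdown
  have hmax := max_of_ascending f hup
  have hw₂b : w₂ ≠ b₁ := by
    rintro rfl
    have := hmin _ hw₁
    omega
  refine ⟨fun k => if k = 0 then {x | x ∈ B ∧ f x < f w₂} else {x | x ∈ B ∧ f w₂ ≤ f x}, ?_⟩
  have c0 : ConnOn G {x | x ∈ B ∧ f x < f w₂} := by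
    refine connOn_of_descending (b := b₁) ⟨S.b₁_mem, (hmin _ hw₁).trans_lt hlt⟩ f ?_
    rintro x ⟨hx, hxw⟩ hxb
    obtain ⟨y, hy, hxy, h⟩ := hdown x hx hxb
    exact ⟨y, ⟨hy, h.trans hxw⟩, hxy, h⟩
  have c1 : ConnOn G {x | x ∈ B ∧ f w₂ ≤ f x} := by
    refine connOn_of_ascending (b := b₂) ⟨S.b₂_mem, hmax _ hw₂⟩ f ?_
    rintro x ⟨hx, hxw⟩ hxb
    obtain ⟨y, hy, hxy, h⟩ := hup x hx hxb
    exact ⟨y, ⟨hy, hxw.trans h.le⟩, hxy, h⟩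
  refine ⟨?_, ?_, ?_, ?_, ?_, ?_, ?_⟩
  · intro k _
    split_ifs <;> exact fun x hx => hx.1
  · intro k _
    split_ifs
    · exact c0
    · exact c1
  · intro k hk l hl hkl x hx hx'
    split_ifs at hx hx' with h1 h2 h2
    · omega
    · exact absurd hx.2 (not_lt.2 hx'.2)
    · exact absurd hx'.2 (not_lt.2 hx.2)
    · omega
  · intro k _
    split_ifs
    · exact ⟨w₁, ⟨hw₁, hlt⟩, hv₁⟩
    · exact ⟨w₂, ⟨hw₂, le_rfl⟩, hv₂⟩
  · intro k hk
    obtain rfl : k = 0 := by omega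
    obtain ⟨y, hy, hxy, h⟩ := hdown w₂ hw₂ hw₂b
    exact ⟨y, ⟨hy, h⟩, w₂, ⟨hw₂, le_rfl⟩, hxy.symm⟩
  · exact ⟨S.b₁_mem, (hmin _ hw₁).trans_lt hlt⟩
  · exact ⟨S.b₂_mem, hmax _ hw₂⟩

/-- The labels strictly between the outer two neighbours of `v` need not span a connected set, so
the middle bag is only the component of `w₂` there. -/
theorem IsSplit.exists_isBagChain_three [Finite V] (S : IsSplit G A B v a₁ b₁ a₂ b₂) {w₁ w₂ w₃ : V}
    (hw₁ : w₁ ∈ B) (hw₂ : w₂ ∈ B) (hw₃ : w₃ ∈ B) (hv₁ : G.Adj v w₁) (hv₂ : G.Adj v w₂)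
    (hv₃ : G.Adj v w₃) (h₁₂ : w₁ ≠ w₂) (h₁₃ : w₁ ≠ w₃) (h₂₃ : w₂ ≠ w₃) :
    ∃ D, IsBagChain G B v b₁ b₂ 3 D := by
  obtain ⟨f, hinj, hup, hdown⟩ := S.exists_numbering
  have hsort : ∃ w₁ ∈ B, ∃ w₂ ∈ B, ∃ w₃ ∈ B, G.Adj v w₁ ∧ G.Adj v w₂ ∧ G.Adj v w₃ ∧
      f w₁ < f w₂ ∧ f w₂ < f w₃ := by
    have n1 := hinj.ne hw₁ hw₂ h₁₂
    have n2 := hinj.ne hw₁ hw₃ h₁₃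
    have n3 := hinj.ne hw₂ hw₃ h₂₃
    rcases lt_or_gt_of_ne n1 with h1 | h1 <;> rcases lt_or_gt_of_ne n2 with h2 | h2 <;>
      rcases lt_or_gt_of_ne n3 with h3 | h3
    · exact ⟨w₁, hw₁, w₂, hw₂, w₃, hw₃, hv₁, hv₂, hv₃, h1, h3⟩
    · exact ⟨w₁, hw₁, w₃, hw₃, w₂, hw₂, hv₁, hv₃, hv₂, h2, h3⟩
    · omega
    · exact ⟨w₃, hw₃, w₁, hw₁, w₂, hw₂, hv₃, hv₁, hv₂, h2, h1⟩
    · exact ⟨w₂, hw₂, w₁, hw₁, w₃, hw₃, hv₂, hv₁, hv₃, h1, h2⟩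
    · omega
    · exact ⟨w₂, hw₂, w₃, hw₃, w₁, hw₁, hv₂, hv₃, hv₁, h3, h2⟩
    · exact ⟨w₃, hw₃, w₂, hw₂, w₁, hw₁, hv₃, hv₂, hv₁, h3, h1⟩
  clear hv₁ hv₂ hv₃ h₁₂ h₁₃ h₂₃ hw₁ hw₂ hw₃ w₁ w₂ w₃
  obtain ⟨w₁, hw₁, w₂, hw₂, w₃, hw₃, hv₁, hv₂, hv₃, h₁₂, h₂₃⟩ := hsort
  have hmin := min_of_descending f hdown
  have hmax := max_of_ascending f hup
  let M : Set V := {x | x ∈ B ∧ f w₁ < f x ∧ f x < f w₃}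
  let D₁ : Set V := {x | x ∈ M ∧ ReachIn G M w₂ x}
  have hw₂M : w₂ ∈ M := ⟨hw₂, h₁₂, h₂₃⟩
  have c0 : ConnOn G {x | x ∈ B ∧ f x ≤ f w₁} := by
    refine connOn_of_descending (b := b₁) ⟨S.b₁_mem, hmin _ hw₁⟩ f ?_
    rintro x ⟨hx, hxw⟩ hxb
    obtain ⟨y, hy, hxy, h⟩ := hdown x hx hxb
    exact ⟨y, ⟨hy, h.le.trans hxw⟩, hxy, h⟩
  have c2 : ConnOn G {x | x ∈ B ∧ f w₃ ≤ f x} := by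
    refine connOn_of_ascending (b := b₂) ⟨S.b₂_mem, hmax _ hw₃⟩ f ?_
    rintro x ⟨hx, hxw⟩ hxb
    obtain ⟨y, hy, hxy, h⟩ := hup x hx hxb
    exact ⟨y, ⟨hy, hxw.trans h.le⟩, hxy, h⟩
  have c1 : ConnOn G D₁ := by
    refine .of_root ⟨hw₂M, .refl _⟩ ?_
    rintro x ⟨hx, hr⟩
    induction hr with
    | refl => exact .refl _
    | @tail y z hy h ih =>
      exact (ih h.2.1).trans (.of_adj h.1 ⟨h.2.1, hy⟩ ⟨h.2.2, hy.tail h⟩)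
  have hext : ∀ x ∈ D₁, ∀ y ∈ M, G.Adj x y → y ∈ D₁ := fun x hx y hy hxy =>
    ⟨hy, hx.2.trans (.of_adj hxy hx.1 hy)⟩
  -- The lowest vertex of the middle bag has a lower neighbour, which cannot lie in the middle
  -- range, as it would then belong to the same component.
  have hlow : ∃ x ∈ {x | x ∈ B ∧ f x ≤ f w₁}, ∃ y ∈ D₁, G.Adj x y := by
    obtain ⟨m, hm, hmin'⟩ := Set.exists_min_image D₁ f (Set.toFinite _) c1.1
    have hmb : m ≠ b₁ := fun e => by
      have := hm.1.2.1
      rw [e] at this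
      exact absurd (hmin _ hw₁) (by omega)
    obtain ⟨y, hy, hmy, h⟩ := hdown m hm.1.1 hmb
    refine ⟨y, ⟨hy, ?_⟩, m, hm, hmy.symm⟩
    by_contra! hc
    exact absurd (hmin' y (hext m hm y ⟨hy, hc, h.trans hm.1.2.2⟩ hmy)) (by omega)
  have hhigh : ∃ x ∈ D₁, ∃ y ∈ {x | x ∈ B ∧ f w₃ ≤ f x}, G.Adj x y := by
    obtain ⟨m, hm, hmax'⟩ := Set.exists_max_image D₁ f (Set.toFinite _) c1.1
    have hmb : m ≠ b₂ := fun e => by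
      have := hm.1.2.2
      rw [e] at this
      exact absurd (hmax _ hw₃) (by omega)
    obtain ⟨y, hy, hmy, h⟩ := hup m hm.1.1 hmb
    refine ⟨m, hm, y, ⟨hy, ?_⟩, hmy⟩
    by_contra! hc
    exact absurd (hmax' y (hext m hm y ⟨hy, hm.1.2.1.trans h, hc⟩ hmy)) (by omega)
  have d01 : ∀ x ∈ {x | x ∈ B ∧ f x ≤ f w₁}, x ∉ D₁ := fun x hx h => by
    have := h.1.2.1; have := hx.2; omega
  have d02 : ∀ x ∈ {x | x ∈ B ∧ f x ≤ f w₁}, x ∉ {x | x ∈ B ∧ f w₃ ≤ f x} := fun x hx h => by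
    have := h.2; have := hx.2; omega
  have d12 : ∀ x ∈ D₁, x ∉ {x | x ∈ B ∧ f w₃ ≤ f x} := fun x hx h => by
    have := h.2; have := hx.1.2.2; omega
  refine ⟨fun k => if k = 0 then {x | x ∈ B ∧ f x ≤ f w₁} else if k = 1 then D₁ else
    {x | x ∈ B ∧ f w₃ ≤ f x}, ?_, ?_, ?_, ?_, ?_, ?_, ?_⟩
  · intro k _
    split_ifs
    · exact fun x hx => hx.1
    · exact fun x hx => hx.1.1
    · exact fun x hx => hx.1
  · intro k _
    split_ifs
    · exact c0
    · exact c1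
    · exact c2
  · intro k hk l hl hkl x hx hx'
    split_ifs at hx hx' with h1 h2 h3 h4 h5 h6 h7
    · omega
    · exact d01 x hx hx'
    · exact d02 x hx hx'
    · exact d01 x hx' hx
    · omega
    · exact d12 x hx hx'
    · exact d02 x hx' hx
    · exact d12 x hx' hx
    · omega
  · intro k _
    split_ifs
    · exact ⟨w₁, ⟨hw₁, le_rfl⟩, hv₁⟩
    · exact ⟨w₂, ⟨hw₂M, .refl _⟩, hv₂⟩
    · exact ⟨w₃, ⟨hw₃, le_rfl⟩, hv₃⟩
  · intro k hk
    obtain rfl | rfl : k = 0 ∨ k = 1 := by omega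
    · exact hlow
    · exact hhigh
  · exact ⟨S.b₁_mem, hmin _ hw₁⟩
  · exact ⟨S.b₂_mem, hmax _ hw₃⟩

end Numbering

/-! ### The graph with one side replaced -/

/-- `F` arises from `G` by replacing the side `B` with the path `x 0, …, x (r - 1)`, which is
placed on `r` neighbours of `v` in `B`; here `r = 3` or `r` is the number of all such neighbours. -/
structure IsReplaced {V : Type*} (G F : SimpleGraph V) (B : Set V) (v a₁ a₂ : V) (r : ℕ)
    (x : ℕ → V) : Prop where
  pos : 0 < r
  le_three : r ≤ 3
  mem : ∀ k < r, x k ∈ B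
  inj : ∀ k < r, ∀ l < r, x k = x l → k = l
  nbr : ∀ k < r, G.Adj v (x k)
  many : ∀ s : Finset V, (∀ y ∈ s, y ∈ B ∧ G.Adj v y) → s.card ≤ 3 → s.card ≤ r
  keep : ∀ p q, p ∉ B → q ∉ B → (F.Adj p q ↔ G.Adj p q)
  adj_v : ∀ k < r, F.Adj v (x k)
  adj_step : ∀ k, k + 1 < r → F.Adj (x k) (x (k + 1))
  adj_first : F.Adj a₁ (x 0)
  adj_last : F.Adj a₂ (x (r - 1))
  edges : ∀ p q, F.Adj p q → (p ∉ B ∧ q ∉ B) ∨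
    (∃ k < r, q = x k ∧ (p = v ∨ p = a₁ ∧ k = 0 ∨ p = a₂ ∧ k + 1 = r ∨ ∃ l, l + 1 = k ∧ p = x l)) ∨
    (∃ k < r, p = x k ∧ (q = v ∨ q = a₁ ∧ k = 0 ∨ q = a₂ ∧ k + 1 = r ∨ ∃ l, l + 1 = k ∧ q = x l))

/-- Extracts from the concrete graph only the adjacencies used later, on the type `V` and with the
path indexed by naturals. -/
theorem exists_isReplaced {V : Type*} {G : SimpleGraph V} {A B : Set V} {v a₁ b₁ a₂ b₂ : V}
    (S : IsSplit G A B v a₁ b₁ a₂ b₂) {m : ℕ} (hm : 0 < m) (w : Fin m → V)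
    (hw : Function.Injective w) (hrange : Set.range w = G.neighborSet v ∩ B) :
    ∃ F x r, IsReplaced G F B v a₁ a₂ r x ∧
      {p | p ∉ B ∨ ∃ k < r, p = x k} = replacedVerts v A w ∧
        replaceSide G s(a₁, b₁) s(a₂, b₂) v A w = F.induce (replacedVerts v A w) := by
  classical
  have hwB : ∀ k, w k ∈ B ∧ G.Adj v (w k) := fun k => by
    have : w k ∈ G.neighborSet v ∩ B := hrange ▸ Set.mem_range_self k
    exact ⟨this.2, this.1⟩
  -- The value `v` beyond the list is a dummy; only indices below `min m 3` are used.
  let x : ℕ → V := fun k => if h : k < m then w ⟨k, h⟩ else v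
  have hx : ∀ k (h : k < m), x k = w ⟨k, h⟩ := fun k h => dif_pos h
  have hxw : ∀ k : Fin m, w k = x k := fun k => (hx k k.2).symm
  have hnA : ∀ k, w k ∉ A := fun k h => S.disj _ h (hwB k).1
  have hnv : ∀ k, w k ≠ v := fun k h => S.v_B (h ▸ (hwB k).1)
  have hnotB : ∀ p, p ∉ B ↔ p ∈ A ∨ p = v := by
    intro p
    constructor
    · intro hp
      rcases S.cover p with h | h | h
      · exact Or.inl h
      · exact absurd h hp
      · exact Or.inr h
    · rintro (h | rfl)
      · exact S.disj p h
      · exact S.v_B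
  have he₁ : ∀ p ∈ A, p ∈ s(a₁, b₁) ↔ p = a₁ := fun p hp => by
    have : p ≠ b₁ := fun h => S.disj p hp (h ▸ S.b₁_mem)
    simp [this]
  have he₂ : ∀ p ∈ A, p ∈ s(a₂, b₂) ↔ p = a₂ := fun p hp => by
    have : p ≠ b₂ := fun h => S.disj p hp (h ▸ S.b₂_mem)
    simp [this]
  refine ⟨SimpleGraph.fromRel fun x y : V =>
    ((x ∈ A ∨ x = v) ∧ (y ∈ A ∨ y = v) ∧ G.Adj x y) ∨
    (∃ k : Fin m, (k : ℕ) < 3 ∧ x = v ∧ y = w k) ∨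
    (∃ k l : Fin m, (l : ℕ) < 3 ∧ (k : ℕ) + 1 = (l : ℕ) ∧ x = w k ∧ y = w l) ∨
    (∃ k : Fin m, (k : ℕ) = 0 ∧ x ∈ A ∧ x ∈ s(a₁, b₁) ∧ y = w k) ∨
    (∃ k : Fin m, (k : ℕ) + 1 = min m 3 ∧ x ∈ A ∧ x ∈ s(a₂, b₂) ∧ y = w k), x, min m 3,
    ⟨?_, ?_, ?_, ?_, ?_, ?_, ?_, ?_, ?_, ?_, ?_, ?_⟩, ?_, rfl⟩
  · omega
  · omega
  · intro k hk
    rw [hx k (by omega)]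
    exact (hwB _).1
  · intro k hk l hl hkl
    rw [hx k (by omega), hx l (by omega)] at hkl
    simpa using hw hkl
  · intro k hk
    rw [hx k (by omega)]
    exact (hwB _).2
  · intro s hs hs3
    have hsub : s ⊆ Finset.univ.image w := by
      intro y hy
      have : y ∈ Set.range w := hrange ▸ ⟨(hs y hy).2, (hs y hy).1⟩
      simpa using this
    have := (Finset.card_le_card hsub).trans Finset.card_image_le
    simp only [Finset.card_univ, Fintype.card_fin] at this
    omega
  · intro p q hp hq
    rw [SimpleGraph.fromRel_adj]
    have hpw : ∀ k, p ≠ w k := fun k h => hp (h ▸ (hwB k).1)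
    have hqw : ∀ k, q ≠ w k := fun k h => hq (h ▸ (hwB k).1)
    constructor
    · rintro ⟨-, (h | ⟨k, h⟩ | ⟨k, l, h⟩ | ⟨k, h⟩ | ⟨k, h⟩) |
        (h | ⟨k, h⟩ | ⟨k, l, h⟩ | ⟨k, h⟩ | ⟨k, h⟩)⟩
      · exact h.2.2
      · exact absurd h.2.2 (hqw k)
      · exact absurd h.2.2.2 (hqw l)
      · exact absurd h.2.2.2 (hqw k)
      · exact absurd h.2.2.2 (hqw k)
      · exact h.2.2.symm
      · exact absurd h.2.2 (hpw k)
      · exact absurd h.2.2.2 (hpw l)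
      · exact absurd h.2.2.2 (hpw k)
      · exact absurd h.2.2.2 (hpw k)
    · exact fun h => ⟨h.ne, Or.inl (Or.inl ⟨(hnotB p).1 hp, (hnotB q).1 hq, h⟩)⟩
  · intro k hk
    rw [hx k (by omega), SimpleGraph.fromRel_adj]
    exact ⟨(hnv _).symm, Or.inl (Or.inr (Or.inl ⟨⟨k, by omega⟩, by simp only; omega, rfl, rfl⟩))⟩
  · intro k hk
    rw [hx k (by omega), hx (k + 1) (by omega), SimpleGraph.fromRel_adj]
    refine ⟨fun h => by simpa using hw h, Or.inl (Or.inr (Or.inr (Or.inl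
      ⟨⟨k, by omega⟩, ⟨k + 1, by omega⟩, by simp only; omega, rfl, rfl, rfl⟩)))⟩
  · rw [hx 0 hm, SimpleGraph.fromRel_adj]
    exact ⟨fun h => hnA _ (h ▸ S.a₁_mem), Or.inl (Or.inr (Or.inr (Or.inr (Or.inl
      ⟨⟨0, hm⟩, rfl, S.a₁_mem, by simp, rfl⟩))))⟩
  · rw [hx (min m 3 - 1) (by omega), SimpleGraph.fromRel_adj]
    exact ⟨fun h => hnA _ (h ▸ S.a₂_mem), Or.inl (Or.inr (Or.inr (Or.inr (Or.inr
      ⟨⟨min m 3 - 1, by omega⟩, by simp only; omega, S.a₂_mem, by simp, rfl⟩))))⟩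
  · have key : ∀ p q, (((p ∈ A ∨ p = v) ∧ (q ∈ A ∨ q = v) ∧ G.Adj p q) ∨
        (∃ k : Fin m, (k : ℕ) < 3 ∧ p = v ∧ q = w k) ∨
        (∃ k l : Fin m, (l : ℕ) < 3 ∧ (k : ℕ) + 1 = (l : ℕ) ∧ p = w k ∧ q = w l) ∨
        (∃ k : Fin m, (k : ℕ) = 0 ∧ p ∈ A ∧ p ∈ s(a₁, b₁) ∧ q = w k) ∨
        (∃ k : Fin m, (k : ℕ) + 1 = min m 3 ∧ p ∈ A ∧ p ∈ s(a₂, b₂) ∧ q = w k)) →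
        (p ∉ B ∧ q ∉ B) ∨ ∃ k < min m 3, q = x k ∧ (p = v ∨ p = a₁ ∧ k = 0 ∨
          p = a₂ ∧ k + 1 = min m 3 ∨ ∃ l, l + 1 = k ∧ p = x l) := by
      rintro p q (h | ⟨k, h1, h2, h3⟩ | ⟨k, l, h1, h2, h3, h4⟩ | ⟨k, h1, h2, h3, h4⟩ |
        ⟨k, h1, h2, h3, h4⟩)
      · exact Or.inl ⟨(hnotB p).2 h.1, (hnotB q).2 h.2.1⟩
      · exact Or.inr ⟨k, by omega, h3.trans (hxw k), Or.inl h2⟩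
      · exact Or.inr ⟨l, by omega, h4.trans (hxw l),
          Or.inr (Or.inr (Or.inr ⟨k, h2, h3.trans (hxw k)⟩))⟩
      · exact Or.inr ⟨k, by omega, h4.trans (hxw k), Or.inr (Or.inl ⟨(he₁ p h2).1 h3, h1⟩)⟩
      · exact Or.inr ⟨k, by omega, h4.trans (hxw k),
          Or.inr (Or.inr (Or.inl ⟨(he₂ p h2).1 h3, h1⟩))⟩
    intro p q hpq
    rw [SimpleGraph.fromRel_adj] at hpq
    rcases hpq.2 with h | h
    · exact (key p q h).imp_right Or.inl
    · exact (key q p h).imp And.symm Or.inr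
  · ext p
    simp only [Set.mem_ofPred, replacedVerts, hnotB, or_assoc]
    refine or_congr_right (or_congr_right ⟨?_, ?_⟩)
    · rintro ⟨k, hk, rfl⟩
      exact ⟨⟨k, by omega⟩, by simp only; omega, hx k _⟩
    · rintro ⟨k, hk, rfl⟩
      exact ⟨k, by omega, hxw k⟩

/-! ### Expanding the new path into bags of `G` -/

section Expand

variable {V : Type*} {G F : SimpleGraph V} {A B : Set V} {v a₁ b₁ a₂ b₂ : V} {r : ℕ} {x : ℕ → V}

theorem exists_isBagChain [Finite V] (S : IsSplit G A B v a₁ b₁ a₂ b₂)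
    (R : IsReplaced G F B v a₁ a₂ r x) : ∃ D, IsBagChain G B v b₁ b₂ r D := by
  have h1 := R.pos
  have h2 := R.le_three
  obtain rfl | rfl | rfl : r = 1 ∨ r = 2 ∨ r = 3 := by omega
  · exact ⟨_, S.exists_isBagChain_one (R.mem 0 h1) (R.nbr 0 h1)⟩
  · exact S.exists_isBagChain_two (R.mem 0 (by omega)) (R.mem 1 (by omega)) (R.nbr 0 (by omega))
      (R.nbr 1 (by omega)) fun h => absurd (R.inj 0 (by omega) 1 (by omega) h) (by omega)
  · exact S.exists_isBagChain_three (R.mem 0 (by omega)) (R.mem 1 (by omega)) (R.mem 2 (by omega))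
      (R.nbr 0 (by omega)) (R.nbr 1 (by omega)) (R.nbr 2 (by omega))
      (fun h => absurd (R.inj 0 (by omega) 1 (by omega) h) (by omega))
      (fun h => absurd (R.inj 0 (by omega) 2 (by omega) h) (by omega))
      (fun h => absurd (R.inj 1 (by omega) 2 (by omega) h) (by omega))

/-- A vertex with at most six neighbours is not the hub of a model of `W₇`. -/
theorem IsWheelModel.not_neighbors_subset {h : V} {K : Fin 7 → Set V} (hM : IsWheelModel F h K)
    (s : Finset V) (hs : s.card ≤ 6) : ∃ q, F.Adj h q ∧ q ∉ s := by
  by_contra! hcon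
  choose y hy hadj using hM.spoke
  obtain ⟨k, -, l, -, hkl, he⟩ := Finset.exists_ne_map_eq_of_card_lt_of_maps_to
    (s := (Finset.univ : Finset (Fin 7))) (t := s) (f := y)
    (by simp only [Finset.card_univ, Fintype.card_fin]; omega) (fun k _ => hcon _ (hadj k))
  exact hM.disj k l hkl _ (hy k) (he ▸ hy l)

/-- Replacing the vertices of a model by disjoint connected sets gives a model. -/
theorem IsWheelModel.expand {V' : Type*} {G' : SimpleGraph V'} {h : V} {h' : V'}
    {K : Fin 7 → Set V} {U : Set V} (hM : IsWheelModel F h K) (hh : h ∈ U) (hK : ∀ k, K k ⊆ U)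
    (σ : V → Set V') (hσ : ∀ p ∈ U, ConnOn G' (σ p))
    (hdisj : ∀ p ∈ U, ∀ q ∈ U, p ≠ q → ∀ z ∈ σ p, z ∉ σ q)
    (hadj : ∀ p ∈ U, ∀ q ∈ U, F.Adj p q → ∃ y ∈ σ p, ∃ z ∈ σ q, G'.Adj y z) (hh' : σ h = {h'}) :
    IsWheelModel G' h' fun k => {z | ∃ p ∈ K k, z ∈ σ p} := by
  refine ⟨?_, ?_, ?_, ?_, ?_⟩
  · intro k
    have hin : ∀ p ∈ K k, ∀ y ∈ σ p, ∀ z ∈ σ p, ReachIn G' {z | ∃ p ∈ K k, z ∈ σ p} y z :=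
      fun p hp y hy z hz => ((hσ p (hK k hp)).2 y hy z hz).mono fun u hu => ⟨p, hp, hu⟩
    have hall : ∀ p, p ∈ K k → ∀ q, ReachIn F (K k) p q → q ∈ K k → ∀ y ∈ σ p, ∀ z ∈ σ q,
        ReachIn G' {z | ∃ p ∈ K k, z ∈ σ p} y z := by
      intro p hp q hpq hq y hy
      induction hpq with
      | refl => exact hin p hp y hy
      | @tail q₁ q₂ _ h ih =>
        intro z hz
        obtain ⟨s, hs, t, ht, hst⟩ := hadj q₁ (hK k h.2.1) q₂ (hK k h.2.2) h.1
        exact ((ih h.2.1 s hs).trans (.of_adj hst ⟨q₁, h.2.1, hs⟩ ⟨q₂, h.2.2, ht⟩)).trans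
          (hin q₂ h.2.2 t ht z hz)
    obtain ⟨p, hp⟩ := (hM.conn k).1
    obtain ⟨y, hy⟩ := (hσ p (hK k hp)).1
    refine .of_root ⟨p, hp, hy⟩ ?_
    rintro z ⟨q, hq, hz⟩
    exact hall p hp q ((hM.conn k).2 p hp q hq) hq y hy z hz
  · rintro k l hkl z ⟨p, hp, hz⟩ ⟨q, hq, hz'⟩
    exact hdisj p (hK k hp) q (hK l hq) (fun e => hM.disj k l hkl p hp (e ▸ hq)) z hz hz'
  · rintro k ⟨p, hp, hz⟩
    exact hdisj p (hK k hp) h hh (fun e => hM.hub k (e ▸ hp)) h' hz (hh' ▸ rfl)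
  · intro k
    obtain ⟨p, hp, hhp⟩ := hM.spoke k
    obtain ⟨y, hy, z, hz, hyz⟩ := hadj h hh p (hK k hp) hhp
    rw [hh'] at hy
    obtain rfl : y = h' := hy
    exact ⟨z, ⟨p, hp, hz⟩, hyz⟩
  · intro k l hkl
    obtain ⟨p, hp, q, hq, hpq⟩ := hM.rim k l hkl
    obtain ⟨y, hy, z, hz, hyz⟩ := hadj p (hK k hp) q (hK l hq) hpq
    exact ⟨y, ⟨p, hp, hy⟩, z, ⟨q, hq, hz⟩, hyz⟩

/-- A model in the graph with `B` replaced gives a model in the original graph. -/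
theorem IsWheelModel.of_isReplaced [Finite V] (S : IsSplit G A B v a₁ b₁ a₂ b₂)
    (R : IsReplaced G F B v a₁ a₂ r x) {h : V} {K : Fin 7 → Set V} (hM : IsWheelModel F h K)
    (hh : h ∈ {p | p ∉ B ∨ ∃ k < r, p = x k}) (hK : ∀ k, K k ⊆ {p | p ∉ B ∨ ∃ k < r, p = x k}) :
    ∃ K', IsWheelModel G h K' := by
  classical
  obtain ⟨D, hD⟩ := exists_isBagChain S R
  have hr := R.le_three
  -- A hub on the new path would have all its neighbours among six vertices, too few for seven
  -- disjoint bags.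
  have hhB : h ∉ B := by
    intro hB
    obtain ⟨k, hk, rfl⟩ := hh.resolve_left (fun h => h hB)
    obtain ⟨q, hq, hqs⟩ := hM.not_neighbors_subset {v, a₁, a₂, x 0, x 1, x 2} Finset.card_le_six
    simp only [Finset.mem_insert, Finset.mem_singleton, not_or] at hqs
    obtain ⟨n1, n2, n3, n4, n5, n6⟩ := hqs
    have hx : ∀ l < 3, q ≠ x l := by
      intro l hl
      obtain rfl | rfl | rfl : l = 0 ∨ l = 1 ∨ l = 2 := by omega
      · exact n4
      · exact n5
      · exact n6
    rcases R.edges _ _ hq with h | ⟨l, hl, h, -⟩ | ⟨l, hl, -, h | h | h | ⟨i, hi, h⟩⟩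
    · exact h.1 hB
    · exact hx l (by omega) h
    · exact n1 h
    · exact n2 h.1
    · exact n3 h.1
    · exact hx i (by omega) h
  -- Vertices outside `B` stay and `x k` expands to `D k`; the remaining vertices of `B`, in no bag
  -- of the model, get the empty set.
  let σ : V → Set V := fun p => {z | (p ∉ B ∧ z = p) ∨ ∃ k < r, p = x k ∧ z ∈ D k}
  have σ1 : ∀ p, p ∉ B → σ p = {p} := by
    intro p hp
    ext z
    simp only [σ, Set.mem_ofPred, Set.mem_singleton_iff]
    constructor
    · rintro (h | ⟨k, hk, rfl, -⟩)
      · exact h.2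
      · exact absurd (R.mem k hk) hp
    · exact fun h => Or.inl ⟨hp, h⟩
  have σ2 : ∀ k < r, σ (x k) = D k := by
    intro k hk
    ext z
    simp only [σ, Set.mem_ofPred]
    constructor
    · rintro (h | ⟨l, hl, hkl, h⟩)
      · exact absurd (R.mem k hk) h.1
      · rwa [R.inj k hk l hl hkl]
    · exact fun h => Or.inr ⟨k, hk, rfl, h⟩
  refine ⟨_, hM.expand hh hK σ ?_ ?_ ?_ (σ1 h hhB)⟩
  · rintro p (hp | ⟨k, hk, rfl⟩)
    · rw [σ1 p hp]
      exact .singleton p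
    · rw [σ2 k hk]
      exact hD.conn k hk
  · rintro p (hp | ⟨k, hk, rfl⟩) q (hq | ⟨l, hl, rfl⟩) hpq z hz hz'
    · rw [σ1 p hp] at hz
      rw [σ1 q hq] at hz'
      exact hpq (hz.symm.trans hz')
    · rw [σ1 p hp] at hz
      rw [σ2 l hl] at hz'
      exact hp ((show z = p from hz) ▸ hD.sub l hl hz')
    · rw [σ2 k hk] at hz
      rw [σ1 q hq] at hz'
      exact hq ((show z = q from hz') ▸ hD.sub k hk hz)
    · rw [σ2 k hk] at hz
      rw [σ2 l hl] at hz'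
      exact hD.disj k hk l hl (fun e => hpq (by rw [e])) z hz hz'
  · have hedge : ∀ p, ∀ k < r, (p = v ∨ p = a₁ ∧ k = 0 ∨ p = a₂ ∧ k + 1 = r ∨
        ∃ l, l + 1 = k ∧ p = x l) → ∃ y ∈ σ p, ∃ z ∈ σ (x k), G.Adj y z := by
      rintro p k hk (rfl | ⟨rfl, rfl⟩ | ⟨rfl, hkr⟩ | ⟨l, rfl, rfl⟩)
      · rw [σ1 p S.v_B, σ2 k hk]
        obtain ⟨z, hz, hpz⟩ := hD.nbr k hk
        exact ⟨p, rfl, z, hz, hpz⟩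
      · rw [σ1 p (S.disj p S.a₁_mem), σ2 0 hk]
        exact ⟨p, rfl, b₁, hD.first, S.adj₁⟩
      · rw [σ1 p (S.disj p S.a₂_mem), σ2 k hk]
        obtain rfl : k = r - 1 := by omega
        exact ⟨p, rfl, b₂, hD.last, S.adj₂⟩
      · rw [σ2 l (by omega), σ2 _ hk]
        exact hD.step l hk
    intro p hp q hq hpq
    rcases R.edges p q hpq with h | ⟨k, hk, rfl, h⟩ | ⟨k, hk, rfl, h⟩
    · rw [σ1 p h.1, σ1 q h.2]
      exact ⟨p, rfl, q, rfl, (R.keep p q h.1 h.2).1 hpq⟩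
    · exact hedge p k hk h
    · obtain ⟨y, hy, z, hz, hyz⟩ := hedge q k hk h
      exact ⟨z, hz, y, hy, hyz.symm⟩

end Expand

/-! ### Rerouting a model through the replaced side -/

/-- The vertices outside `B` that have neighbours in `B`. -/
def cutTerminal {V : Type*} (v a₁ a₂ : V) : Fin 3 → V := ![a₁, a₂, v]

/-- The vertex set `W` can be passed between `B` and its complement along `a₁b₁`, along `a₂b₂`, or
at `v`. -/
def HasPass {V : Type*} (B : Set V) (v a₁ b₁ a₂ b₂ : V) : Fin 3 → Set V → Prop :=
  ![fun W => a₁ ∈ W ∧ b₁ ∈ W, fun W => a₂ ∈ W ∧ b₂ ∈ W, fun W => v ∈ W ∧ ∃ y ∈ W, y ∈ B]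

section Passes

variable {V : Type*} {G F : SimpleGraph V} {A B : Set V} {v a₁ b₁ a₂ b₂ : V} {r : ℕ} {x : ℕ → V}

theorem HasPass.mono {j : Fin 3} {W W' : Set V} (h : HasPass B v a₁ b₁ a₂ b₂ j W) (hW : W ⊆ W') :
    HasPass B v a₁ b₁ a₂ b₂ j W' := by
  fin_cases j
  · exact ⟨hW h.1, hW h.2⟩
  · exact ⟨hW h.1, hW h.2⟩
  · exact ⟨hW h.1, h.2.imp fun _ h => ⟨hW h.1, h.2⟩⟩

theorem HasPass.terminal_mem {j : Fin 3} {W : Set V} (h : HasPass B v a₁ b₁ a₂ b₂ j W) :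
    cutTerminal v a₁ a₂ j ∈ W := by
  fin_cases j <;> exact h.1

/-- Any edge crossing the border of `B` yields a pass, and its outer end determines which one. -/
theorem IsSplit.exists_pass_of_adj (S : IsSplit G A B v a₁ b₁ a₂ b₂) {W : Set V} {p q : V}
    (hp : p ∈ W) (hpB : p ∉ B) (hq : q ∈ W) (hqB : q ∈ B) (hpq : G.Adj p q) :
    ∃ j, p = cutTerminal v a₁ a₂ j ∧ HasPass B v a₁ b₁ a₂ b₂ j W := by
  rcases S.cover p with h | h | rfl
  · rcases S.cross p h q hqB hpq with ⟨rfl, rfl⟩ | ⟨rfl, rfl⟩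
    · exact ⟨0, rfl, hp, hq⟩
    · exact ⟨1, rfl, hp, hq⟩
  · exact absurd h hpB
  · exact ⟨2, rfl, hp, q, hq, hqB⟩

theorem IsSplit.exists_pass (S : IsSplit G A B v a₁ b₁ a₂ b₂) {W : Set V} (hW : ConnOn G W)
    {p q : V} (hp : p ∈ W) (hpB : p ∉ B) (hq : q ∈ W) (hqB : q ∈ B) :
    ∃ j, HasPass B v a₁ b₁ a₂ b₂ j W := by
  obtain ⟨s, hs, hsB, t, ht, htB, hst⟩ := hW.exists_adj (T := B) hq hqB hp hpB
  obtain ⟨j, -, hj⟩ := S.exists_pass_of_adj ht htB hs hsB hst.symm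
  exact ⟨j, hj⟩

/-- If a connected set has at most one pass, then its part outside `B` is connected. -/
theorem IsSplit.connOn_diff (S : IsSplit G A B v a₁ b₁ a₂ b₂) {W : Set V} (hW : ConnOn G W)
    {p : V} (hp : p ∈ W) (hpB : p ∉ B)
    (hone : ∀ i j, HasPass B v a₁ b₁ a₂ b₂ i W → HasPass B v a₁ b₁ a₂ b₂ j W → i = j) :
    ConnOn G (W \ B) := by
  classical
  -- With at most one pass, all crossing edges have the same outer end `t`, onto which the part in
  -- `B` is contracted. Without crossing edges, any outer vertex serves.
  have hanchor : ∃ t ∈ W \ B, ∀ p ∈ W, p ∉ B → ∀ q ∈ W, q ∈ B → G.Adj p q → p = t := by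
    by_cases hex : ∃ p ∈ W, p ∉ B ∧ ∃ q ∈ W, q ∈ B ∧ G.Adj p q
    · obtain ⟨t, ht, htB, q, hq, hqB, htq⟩ := hex
      refine ⟨t, ⟨ht, htB⟩, fun s hs hsB u hu huB hsu => ?_⟩
      obtain ⟨i, hi, hi'⟩ := S.exists_pass_of_adj ht htB hq hqB htq
      obtain ⟨j, hj, hj'⟩ := S.exists_pass_of_adj hs hsB hu huB hsu
      rw [hi, hj, hone i j hi' hj']
    · exact ⟨p, ⟨hp, hpB⟩, fun s hs hsB u hu huB hsu =>
        absurd ⟨s, hs, hsB, u, hu, huB, hsu⟩ hex⟩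
  obtain ⟨t, ht, hmain⟩ := hanchor
  have π1 : ∀ u, u ∈ B → (if u ∈ B then t else u) = t := fun u hu => if_pos hu
  have π2 : ∀ u, u ∉ B → (if u ∈ B then t else u) = u := fun u hu => if_neg hu
  refine hW.map (fun u => if u ∈ B then t else u) ?_ ?_ ?_
  · intro u hu
    by_cases huB : u ∈ B
    · rw [π1 u huB]; exact ht
    · rw [π2 u huB]; exact ⟨hu, huB⟩
  · intro u hu w hw huw
    by_cases huB : u ∈ B <;> by_cases hwB : w ∈ B
    · rw [π1 u huB, π1 w hwB]; exact .refl _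
    · rw [π1 u huB, π2 w hwB, hmain w hw hwB u hu huB huw.symm]; exact .refl _
    · rw [π2 u huB, π1 w hwB, hmain u hu huB w hw hwB huw]; exact .refl _
    · rw [π2 u huB, π2 w hwB]; exact .of_adj huw ⟨hu, huB⟩ ⟨hw, hwB⟩
  · intro u hu
    exact ⟨u, hu.1, by rw [π2 u hu.2]; exact .refl _⟩

theorem IsReplaced.connOn_diff (R : IsReplaced G F B v a₁ a₂ r x) {W : Set V}
    (hW : ConnOn G (W \ B)) : ConnOn F (W \ B) :=
  hW.map id (fun _ h => h) (fun p hp q hq hpq => .of_adj ((R.keep p q hp.2 hq.2).2 hpq) hp hq)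
    fun u hu => ⟨u, hu, .refl _⟩

theorem IsReplaced.connOn_segment (R : IsReplaced G F B v a₁ a₂ r x) {s : ℕ} (hs : s < r) :
    ConnOn F {p | ∃ k, s ≤ k ∧ k < r ∧ p = x k} := by
  have h : ∀ k, s + k < r → ReachIn F {p | ∃ k, s ≤ k ∧ k < r ∧ p = x k} (x s) (x (s + k)) := by
    intro k
    induction k with
    | zero => exact fun _ => .refl _
    | succ k ih =>
      intro hk
      exact (ih (by omega)).trans (.of_adj (R.adj_step (s + k) hk)
        ⟨s + k, by omega, by omega, rfl⟩ ⟨s + k + 1, by omega, hk, rfl⟩)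
  refine .of_root ⟨s, le_rfl, hs, rfl⟩ ?_
  rintro _ ⟨k, hk, hkr, rfl⟩
  have := h (k - s) (by omega)
  rwa [show s + (k - s) = k by omega] at this

/-- Replacing the part in `B` of a connected set by a connected set that is adjacent to all the
terminals at which it can be passed. -/
theorem IsSplit.connOn_replace (S : IsSplit G A B v a₁ b₁ a₂ b₂)
    (R : IsReplaced G F B v a₁ a₂ r x) {W Y : Set V} (hW : ConnOn G W) {p : V} (hp : p ∈ W)
    (hpB : p ∈ B) (hY : ConnOn F Y)
    (hadj : ∀ j, HasPass B v a₁ b₁ a₂ b₂ j W → ∃ z ∈ Y, F.Adj (cutTerminal v a₁ a₂ j) z) :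
    ConnOn F ((W \ B) ∪ Y) := by
  classical
  obtain ⟨t, ht⟩ := hY.1
  have π1 : ∀ u, u ∈ B → (if u ∈ B then t else u) = t := fun u hu => if_pos hu
  have π2 : ∀ u, u ∉ B → (if u ∈ B then t else u) = u := fun u hu => if_neg hu
  have hYr : ∀ z ∈ Y, ReachIn F ((W \ B) ∪ Y) z t := fun z hz =>
    (hY.2 z hz t ht).mono Set.subset_union_right
  have hkey : ∀ u ∈ W, u ∉ B → ∀ w ∈ W, w ∈ B → G.Adj u w → ReachIn F ((W \ B) ∪ Y) u t := by
    intro u hu huB w hw hwB huw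
    obtain ⟨j, rfl, hj⟩ := S.exists_pass_of_adj hu huB hw hwB huw
    obtain ⟨z, hz, hjz⟩ := hadj j hj
    exact (ReachIn.of_adj hjz (Or.inl ⟨hu, huB⟩) (Or.inr hz)).trans (hYr z hz)
  -- The part in `B` is contracted to a vertex `t` of `Y`; a crossing edge becomes a walk through
  -- `Y`.
  refine hW.map (fun u => if u ∈ B then t else u) ?_ ?_ ?_
  · intro u hu
    by_cases huB : u ∈ B
    · rw [π1 u huB]; exact Or.inr ht
    · rw [π2 u huB]; exact Or.inl ⟨hu, huB⟩
  · intro u hu w hw huw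
    by_cases huB : u ∈ B <;> by_cases hwB : w ∈ B
    · rw [π1 u huB, π1 w hwB]; exact .refl _
    · rw [π1 u huB, π2 w hwB]; exact (hkey w hw hwB u hu huB huw.symm).symm
    · rw [π2 u huB, π1 w hwB]; exact hkey u hu huB w hw hwB huw
    · rw [π2 u huB, π2 w hwB]
      exact .of_adj ((R.keep u w huB hwB).2 huw) (Or.inl ⟨hu, huB⟩) (Or.inl ⟨hw, hwB⟩)
  · rintro u (hu | hu)
    · exact ⟨u, hu.1, by rw [π2 u hu.2]; exact .refl _⟩
    · exact ⟨p, hp, by rw [π1 p hpB]; exact (hYr u hu).symm⟩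

/-- Distributing the new path among the bags: the bag `K a` loses its part in `B` and gets `Y a`. -/
theorem IsWheelModel.distribute (S : IsSplit G A B v a₁ b₁ a₂ b₂)
    (R : IsReplaced G F B v a₁ a₂ r x) {h : V} {K : Fin 7 → Set V} (hM : IsWheelModel G h K)
    (hh : h ∉ B) (Y : Fin 7 → Set V) (hYx : ∀ a, ∀ z ∈ Y a, ∃ k < r, z = x k)
    (hYd : ∀ a b, a ≠ b → ∀ z ∈ Y a, z ∉ Y b)
    (hY : ∀ a, (Y a).Nonempty → ConnOn F (Y a) ∧
      ((∃ y ∈ K a, y ∈ B) ∨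
        ∃ j, cutTerminal v a₁ a₂ j ∈ K a \ B ∧ ∃ z ∈ Y a, F.Adj (cutTerminal v a₁ a₂ j) z) ∧
      (∃ z ∈ (K a \ B) ∪ Y a, F.Adj h z) ∧
      (∀ j, HasPass B v a₁ b₁ a₂ b₂ j (K a) → ∃ z ∈ Y a, F.Adj (cutTerminal v a₁ a₂ j) z) ∧
      ∀ d, ¬ (Y d).Nonempty → (SimpleGraph.cycleGraph 7).Adj a d →
        ∀ j, HasPass B v a₁ b₁ a₂ b₂ j (K a ∪ K d) →
          ∃ z ∈ Y a, F.Adj (cutTerminal v a₁ a₂ j) z)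
    (hYY : ∀ a b, (Y a).Nonempty → (Y b).Nonempty → (SimpleGraph.cycleGraph 7).Adj a b →
      ∃ y ∈ Y a, ∃ z ∈ Y b, F.Adj y z)
    (hN : ∀ a, ¬ (Y a).Nonempty → ConnOn G (K a \ B) ∧ ∃ y ∈ K a, y ∉ B ∧ G.Adj h y)
    (hNN : ∀ a b, ¬ (Y a).Nonempty → ¬ (Y b).Nonempty → (SimpleGraph.cycleGraph 7).Adj a b →
      ∃ y ∈ K a \ B, ∃ z ∈ K b \ B, G.Adj y z) :
    ∃ K', (∀ k, K' k ⊆ {p | p ∉ B ∨ ∃ k < r, p = x k}) ∧ IsWheelModel F h K' := by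
  have hYB : ∀ a, ∀ z ∈ Y a, z ∈ B := fun a z hz => by
    obtain ⟨k, hk, rfl⟩ := hYx a z hz
    exact R.mem k hk
  have hmixed : ∀ a d, (Y a).Nonempty → ¬ (Y d).Nonempty → (SimpleGraph.cycleGraph 7).Adj a d →
      ∃ y ∈ (K a \ B) ∪ Y a, ∃ z ∈ (K d \ B) ∪ Y d, F.Adj y z := by
    intro a d ha hd had
    obtain ⟨-, -, -, -, hpass⟩ := hY a ha
    obtain ⟨y, hy, z, hz, hyz⟩ := hM.rim a d had
    have hfin : ∀ j, cutTerminal v a₁ a₂ j ∈ K d \ B → HasPass B v a₁ b₁ a₂ b₂ j (K a ∪ K d) →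
        ∃ y ∈ (K a \ B) ∪ Y a, ∃ z ∈ (K d \ B) ∪ Y d, F.Adj y z := by
      intro j hj hj'
      obtain ⟨u, hu, huj⟩ := hpass d hd had j hj'
      exact ⟨u, Or.inr hu, _, Or.inl hj, huj.symm⟩
    -- If the rim edge ends inside `B`, then `K d` itself crosses the border, and its terminal gives
    -- the new rim edge. Otherwise the edge either crosses the border or survives unchanged.
    by_cases hzB : z ∈ B
    · obtain ⟨⟨w, hw⟩, -⟩ := (hN d hd).1
      obtain ⟨s, hs, hsB, t, ht, htB, hst⟩ := (hM.conn d).exists_adj (T := B) hz hzB hw.1 hw.2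
      obtain ⟨j, rfl, hj⟩ := S.exists_pass_of_adj ht htB hs hsB hst.symm
      exact hfin j ⟨ht, htB⟩ (hj.mono Set.subset_union_right)
    · by_cases hyB : y ∈ B
      · obtain ⟨j, rfl, hj⟩ := S.exists_pass_of_adj (W := K a ∪ K d) (Or.inr hz) hzB (Or.inl hy)
          hyB hyz.symm
        exact hfin j ⟨hz, hzB⟩ hj
      · exact ⟨y, Or.inl ⟨hy, hyB⟩, z, Or.inl ⟨hz, hzB⟩, (R.keep y z hyB hzB).2 hyz⟩
  refine ⟨fun a => (K a \ B) ∪ Y a, ?_, ?_, ?_, ?_, ?_, ?_⟩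
  · rintro a z (hz | hz)
    · exact Or.inl hz.2
    · exact Or.inr (hYx a z hz)
  · intro a
    by_cases ha : (Y a).Nonempty
    · obtain ⟨hc, hmeet, -, hp, -⟩ := hY a ha
      by_cases hex : ∃ y ∈ K a, y ∈ B
      · obtain ⟨y, hy, hyB⟩ := hex
        exact S.connOn_replace R (hM.conn a) hy hyB hc hp
      · obtain ⟨j, hj, z, hz, hjz⟩ := hmeet.resolve_left hex
        have hKa : K a \ B = K a := by
          ext u
          exact ⟨fun h => h.1, fun h => ⟨h, fun hB => hex ⟨u, h, hB⟩⟩⟩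
        refine (R.connOn_diff (W := K a) ?_).union hc hj hz (Or.inr hjz)
        rw [hKa]
        exact hM.conn a
    · rw [Set.not_nonempty_iff_eq_empty.1 ha, Set.union_empty]
      exact R.connOn_diff (hN a ha).1
  · rintro a b hab z (hz | hz) (hz' | hz')
    · exact hM.disj a b hab z hz.1 hz'.1
    · exact hz.2 (hYB b z hz')
    · exact hz'.2 (hYB a z hz)
    · exact hYd a b hab z hz hz'
  · rintro a (hz | hz)
    · exact hM.hub a hz.1
    · exact hh (hYB a h hz)
  · intro a
    by_cases ha : (Y a).Nonempty
    · exact (hY a ha).2.2.1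
    · obtain ⟨y, hy, hyB, hadj⟩ := (hN a ha).2
      exact ⟨y, Or.inl ⟨hy, hyB⟩, (R.keep h y hh hyB).2 hadj⟩
  · intro a b hab
    by_cases ha : (Y a).Nonempty <;> by_cases hb : (Y b).Nonempty
    · obtain ⟨y, hy, z, hz, hyz⟩ := hYY a b ha hb hab
      exact ⟨y, Or.inr hy, z, Or.inr hz, hyz⟩
    · exact hmixed a b ha hb hab
    · obtain ⟨y, hy, z, hz, hyz⟩ := hmixed b a hb ha hab.symm
      exact ⟨z, hz, y, hy, hyz.symm⟩
    · obtain ⟨y, hy, z, hz, hyz⟩ := hNN a b ha hb hab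
      exact ⟨y, Or.inl hy, z, Or.inl hz, (R.keep y z hy.2 hz.2).2 hyz⟩

end Passes

/-! ### One bag receives the new path -/

theorem cycleGraph_seven_no_triangle (k l m : Fin 7) (h1 : (SimpleGraph.cycleGraph 7).Adj k l)
    (h2 : (SimpleGraph.cycleGraph 7).Adj l m) (h3 : (SimpleGraph.cycleGraph 7).Adj k m) :
    False := by
  rw [cycleGraph_seven_adj] at h1 h2 h3
  revert k l m
  decide

/-- A pairwise intersecting family of vertices and edges of the 7-cycle has a common vertex. -/
theorem exists_center (L : Fin 7 → Fin 7 → Prop) (hsymm : ∀ k m, L k m → L m k)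
    (hadj : ∀ k m, L k m → k = m ∨ (SimpleGraph.cycleGraph 7).Adj k m)
    (hint : ∀ k m a b, L k m → L a b → k = a ∨ k = b ∨ m = a ∨ m = b) :
    ∃ l, ∀ k m, L k m → k = l ∨ m = l := by
  -- Without a centre there is an edge `km`, a member through `m` avoiding `k`, and one through `k`
  -- avoiding `m`; the last two can only meet in a third vertex, which makes a triangle.
  by_contra! hcon
  obtain ⟨k, m, hkm, -, -⟩ := hcon 0
  have h1 : ∃ b, L m b ∧ m ≠ k ∧ b ≠ k := by
    obtain ⟨a, b, hab, hak, hbk⟩ := hcon k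
    rcases hint k m a b hkm hab with h | h | h | h
    · exact absurd h.symm hak
    · exact absurd h.symm hbk
    · subst h
      exact ⟨b, hab, hak, hbk⟩
    · subst h
      exact ⟨a, hsymm _ _ hab, hbk, hak⟩
  have h2 : ∃ d, L k d ∧ d ≠ m := by
    obtain ⟨c, d, hcd, hcm, hdm⟩ := hcon m
    rcases hint k m c d hkm hcd with h | h | h | h
    · subst h
      exact ⟨d, hcd, hdm⟩
    · subst h
      exact ⟨c, hsymm _ _ hcd, hcm⟩
    · exact absurd h.symm hcm
    · exact absurd h.symm hdm
  obtain ⟨b, hmb, hmk, hbk⟩ := h1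
  obtain ⟨d, hkd, hdm⟩ := h2
  rcases hint m b k d hmb hkd with h | h | h | h
  · exact hmk h
  · exact hdm h.symm
  · exact hbk h
  · subst h
    exact cycleGraph_seven_no_triangle k m b ((hadj _ _ hkm).resolve_left hmk.symm)
      ((hadj _ _ hmb).resolve_left hdm.symm) ((hadj _ _ hkd).resolve_left hbk.symm)

section Receiver

variable {V : Type*} {G F : SimpleGraph V} {A B : Set V} {v a₁ b₁ a₂ b₂ : V} {r : ℕ} {x : ℕ → V}

theorem IsSplit.terminal_notMem (S : IsSplit G A B v a₁ b₁ a₂ b₂) (j : Fin 3) :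
    cutTerminal v a₁ a₂ j ∉ B := by
  fin_cases j
  · exact S.disj _ S.a₁_mem
  · exact S.disj _ S.a₂_mem
  · exact S.v_B

theorem IsReplaced.exists_adj_terminal (R : IsReplaced G F B v a₁ a₂ r x) (j : Fin 3) :
    ∃ z ∈ {p | ∃ k, 0 ≤ k ∧ k < r ∧ p = x k}, F.Adj (cutTerminal v a₁ a₂ j) z := by
  have := R.pos
  fin_cases j
  · exact ⟨x 0, ⟨0, le_rfl, R.pos, rfl⟩, R.adj_first⟩
  · exact ⟨x (r - 1), ⟨r - 1, by omega, by omega, rfl⟩, R.adj_last⟩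
  · exact ⟨x 0, ⟨0, le_rfl, R.pos, rfl⟩, R.adj_v 0 R.pos⟩

/-- If all bags other than `K l` and all rim edges that avoid `K l` survive the removal of `B`,
then the whole new path can be given to `K l`. -/
theorem IsWheelModel.replace_of_receiver (S : IsSplit G A B v a₁ b₁ a₂ b₂)
    (R : IsReplaced G F B v a₁ a₂ r x) {h : V} {K : Fin 7 → Set V} (hM : IsWheelModel G h K)
    (hh : h ∉ B) (l : Fin 7)
    (hN : ∀ a, a ≠ l → ConnOn G (K a \ B) ∧ ∃ y ∈ K a, y ∉ B ∧ G.Adj h y)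
    (hNN : ∀ a b, a ≠ l → b ≠ l → (SimpleGraph.cycleGraph 7).Adj a b →
      ∃ y ∈ K a \ B, ∃ z ∈ K b \ B, G.Adj y z) :
    ∃ K', (∀ k, K' k ⊆ {p | p ∉ B ∨ ∃ k < r, p = x k}) ∧ IsWheelModel F h K' := by
  classical
  let X : Set V := {p | ∃ k, 0 ≤ k ∧ k < r ∧ p = x k}
  have hXne : X.Nonempty := ⟨x 0, 0, le_rfl, R.pos, rfl⟩
  -- If `K l` neither meets `B` nor contains a terminal, the new path could not be attached to it;
  -- but then all its edges survive and no bag needs the path.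
  by_cases hT : (∃ y ∈ K l, y ∈ B) ∨ ∃ j, cutTerminal v a₁ a₂ j ∈ K l
  · obtain ⟨Y, hYl, hYn⟩ : ∃ Y : Fin 7 → Set V, Y l = X ∧ ∀ a, a ≠ l → Y a = ∅ :=
      ⟨fun a => if a = l then X else ∅, if_pos rfl, fun a ha => if_neg ha⟩
    have hYne : ∀ a, (Y a).Nonempty → a = l := by
      intro a ha
      by_contra hal
      rw [hYn a hal] at ha
      exact Set.not_nonempty_empty ha
    have hYnne : ∀ a, ¬ (Y a).Nonempty → a ≠ l := by
      rintro a ha rfl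
      exact ha (hYl.symm ▸ hXne)
    refine hM.distribute S R hh Y ?_ ?_ ?_ ?_ ?_ ?_
    · intro a z hz
      obtain rfl := hYne a ⟨z, hz⟩
      rw [hYl] at hz
      obtain ⟨k, -, hk, rfl⟩ := hz
      exact ⟨k, hk, rfl⟩
    · intro a b hab z hz hz'
      exact hab ((hYne a ⟨z, hz⟩).trans (hYne b ⟨z, hz'⟩).symm)
    · intro a ha
      obtain rfl := hYne a ha
      rw [hYl]
      refine ⟨R.connOn_segment R.pos, ?_, ?_, fun j _ => R.exists_adj_terminal j,
        fun _ _ _ j _ => R.exists_adj_terminal j⟩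
      · refine hT.imp_right ?_
        rintro ⟨j, hj⟩
        exact ⟨j, ⟨hj, S.terminal_notMem j⟩, R.exists_adj_terminal j⟩
      · obtain ⟨y, hy, hhy⟩ := hM.spoke a
        by_cases hyB : y ∈ B
        · obtain ⟨j, rfl, -⟩ := S.exists_pass_of_adj (W := Set.univ) trivial hh trivial hyB hhy
          obtain ⟨z, hz, hjz⟩ := R.exists_adj_terminal j
          exact ⟨z, Or.inr hz, hjz⟩
        · exact ⟨y, Or.inl ⟨hy, hyB⟩, (R.keep h y hh hyB).2 hhy⟩
    · intro a b ha hb hab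
      exact absurd ((hYne a ha).trans (hYne b hb).symm) hab.ne
    · exact fun a ha => hN a (hYnne a ha)
    · exact fun a b ha hb hab => hNN a b (hYnne a ha) (hYnne b hb) hab
  · push Not at hT
    obtain ⟨hT1, hT2⟩ := hT
    have hKl : K l \ B = K l := by
      ext u
      exact ⟨fun h => h.1, fun h => ⟨h, hT1 u h⟩⟩
    have hedge : ∀ b, (SimpleGraph.cycleGraph 7).Adj l b →
        ∃ y ∈ K l \ B, ∃ z ∈ K b \ B, G.Adj y z := by
      intro b hlb
      obtain ⟨y, hy, z, hz, hyz⟩ := hM.rim l b hlb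
      refine ⟨y, ⟨hy, hT1 y hy⟩, z, ⟨hz, fun hzB => ?_⟩, hyz⟩
      obtain ⟨j, rfl, -⟩ := S.exists_pass_of_adj (W := Set.univ) trivial (hT1 y hy) trivial hzB hyz
      exact hT2 j hy
    refine hM.distribute S R hh (fun _ => ∅) (by simp) (by simp) (by simp) (by simp) ?_ ?_
    · intro a _
      by_cases hal : a = l
      · subst hal
        rw [hKl]
        obtain ⟨y, hy, hhy⟩ := hM.spoke a
        exact ⟨hM.conn a, y, hy, hT1 y hy, hhy⟩
      · exact hN a hal
    · intro a b _ _ hab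
      by_cases hal : a = l
      · subst hal
        exact hedge b hab
      · by_cases hbl : b = l
        · subst hbl
          obtain ⟨y, hy, z, hz, hyz⟩ := hedge a hab.symm
          exact ⟨z, hz, y, hy, hyz.symm⟩
        · exact hNN a b hal hbl hab

/-- Two bags with an edge between them that are passed at most once are joined outside `B`. -/
theorem IsWheelModel.exists_edge_diff (S : IsSplit G A B v a₁ b₁ a₂ b₂) {h : V}
    {K : Fin 7 → Set V} (hM : IsWheelModel G h K) {k m : Fin 7}
    (hkm : (SimpleGraph.cycleGraph 7).Adj k m) {p q : V} (hp : p ∈ K k) (hpB : p ∉ B)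
    (hq : q ∈ K m) (hqB : q ∉ B)
    (hone : ∀ i j, HasPass B v a₁ b₁ a₂ b₂ i (K k ∪ K m) →
      HasPass B v a₁ b₁ a₂ b₂ j (K k ∪ K m) → i = j) :
    ∃ y ∈ K k \ B, ∃ z ∈ K m \ B, G.Adj y z := by
  obtain ⟨y, hy, z, hz, hyz⟩ := hM.rim k m hkm
  -- With at most one pass the union stays connected outside `B`, so some surviving edge joins its
  -- two parts.
  have hu : ConnOn G (K k ∪ K m) := (hM.conn k).union (hM.conn m) hy hz (Or.inr hyz)
  obtain ⟨s, hs, hsk, t, ht, htk, hst⟩ := (S.connOn_diff hu (Or.inl hp) hpB hone).exists_adj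
    (T := K k) ⟨Or.inl hp, hpB⟩ hp ⟨Or.inr hq, hqB⟩ (hM.disj m k hkm.ne' q hq)
  exact ⟨s, ⟨hsk, hs.2⟩, t, ⟨ht.1.resolve_left htk, ht.2⟩, hst⟩

/-- Bags and rim edges that are passed at most once survive the removal of `B`. -/
theorem IsWheelModel.survive (S : IsSplit G A B v a₁ b₁ a₂ b₂) {h : V} {K : Fin 7 → Set V}
    (hM : IsWheelModel G h K) {P : Fin 7 → Prop} (hQ : ∀ a, P a → ∃ y ∈ K a, y ∉ B ∧ G.Adj h y)
    (hone : ∀ k m, P k → P m → (k = m ∨ (SimpleGraph.cycleGraph 7).Adj k m) →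
      ∀ i j, HasPass B v a₁ b₁ a₂ b₂ i (K k ∪ K m) →
      HasPass B v a₁ b₁ a₂ b₂ j (K k ∪ K m) → i = j) :
    (∀ a, P a → ConnOn G (K a \ B) ∧ ∃ y ∈ K a, y ∉ B ∧ G.Adj h y) ∧
      ∀ a b, P a → P b → (SimpleGraph.cycleGraph 7).Adj a b →
        ∃ y ∈ K a \ B, ∃ z ∈ K b \ B, G.Adj y z := by
  constructor
  · intro a ha
    obtain ⟨y, hy, hyB, hhy⟩ := hQ a ha
    exact ⟨S.connOn_diff (hM.conn a) hy hyB fun i j hi hj => hone a a ha ha (Or.inl rfl) i j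
      (by rwa [Set.union_self]) (by rwa [Set.union_self]), y, hy, hyB, hhy⟩
  · intro a b ha hb hab
    obtain ⟨y, hy, hyB, -⟩ := hQ a ha
    obtain ⟨z, hz, hzB, -⟩ := hQ b hb
    exact hM.exists_edge_diff S hab hy hyB hz hzB (hone a b ha hb (Or.inr hab))

/-- Pairs of bags that both contain `t` have a bag in common. -/
theorem IsWheelModel.exists_common {h : V} {K : Fin 7 → Set V} (hM : IsWheelModel G h K) {t : V}
    {k m a b : Fin 7} (h1 : t ∈ K k ∪ K m) (h2 : t ∈ K a ∪ K b) :
    k = a ∨ k = b ∨ m = a ∨ m = b := by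
  by_contra! hcon
  rcases h1 with h1 | h1 <;> rcases h2 with h2 | h2
  · exact hM.disj _ _ hcon.1 t h1 h2
  · exact hM.disj _ _ hcon.2.1 t h1 h2
  · exact hM.disj _ _ hcon.2.2.1 t h1 h2
  · exact hM.disj _ _ hcon.2.2.2 t h1 h2

/-- If every bag has a neighbour of the hub outside `B`, then some bag can receive the new path. -/
theorem IsWheelModel.replace_of_forall (S : IsSplit G A B v a₁ b₁ a₂ b₂)
    (R : IsReplaced G F B v a₁ a₂ r x) {h : V} {K : Fin 7 → Set V} (hM : IsWheelModel G h K)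
    (hh : h ∉ B) (hQ : ∀ a, ∃ y ∈ K a, y ∉ B ∧ G.Adj h y) :
    ∃ K', (∀ k, K' k ⊆ {p | p ∉ B ∨ ∃ k < r, p = x k}) ∧ IsWheelModel F h K' := by
  -- `L` holds the bags and rim edges with two different passes. Two pairs of passes out of three
  -- overlap, so any two members of `L` share a bag, and `exists_center` supplies the receiver.
  let L : Fin 7 → Fin 7 → Prop := fun k m => (k = m ∨ (SimpleGraph.cycleGraph 7).Adj k m) ∧
    ∃ i j, i ≠ j ∧ HasPass B v a₁ b₁ a₂ b₂ i (K k ∪ K m) ∧ HasPass B v a₁ b₁ a₂ b₂ j (K k ∪ K m)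
  obtain ⟨l, hl⟩ := exists_center L
    (fun k m ⟨h1, h2⟩ => ⟨h1.imp Eq.symm SimpleGraph.Adj.symm, by rwa [Set.union_comm]⟩)
    (fun k m h => h.1) (by
      rintro k m a b ⟨-, i, j, hij, hi, hj⟩ ⟨-, i', j', hij', hi', hj'⟩
      have : i = i' ∨ i = j' ∨ j = i' ∨ j = j' := by omega
      rcases this with rfl | rfl | rfl | rfl
      · exact hM.exists_common hi.terminal_mem hi'.terminal_mem
      · exact hM.exists_common hi.terminal_mem hj'.terminal_mem
      · exact hM.exists_common hj.terminal_mem hi'.terminal_mem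
      · exact hM.exists_common hj.terminal_mem hj'.terminal_mem)
  obtain ⟨h1, h2⟩ := hM.survive S (P := fun a => a ≠ l) (fun a _ => hQ a) fun k m hk hm hkm i j
    hi hj => by
      by_contra hij
      rcases hl k m ⟨hkm, i, j, hij, hi, hj⟩ with h | h
      · exact hk h
      · exact hm h
  exact hM.replace_of_receiver S R hh l h1 h2

/-- If all bags but `K l` have a neighbour of the hub outside `B`, and one of the passes is not
available, then `K l` can receive the new path. -/
theorem IsWheelModel.replace_of_forall_ne (S : IsSplit G A B v a₁ b₁ a₂ b₂)
    (R : IsReplaced G F B v a₁ a₂ r x) {h : V} {K : Fin 7 → Set V} (hM : IsWheelModel G h K)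
    (hh : h ∉ B) (l : Fin 7) (hQ : ∀ a, a ≠ l → ∃ y ∈ K a, y ∉ B ∧ G.Adj h y)
    (hl : ∃ y ∈ K l, y ∈ B) {i₀ : Fin 3} (hi₀ : ∀ a, cutTerminal v a₁ a₂ i₀ ∉ K a) :
    ∃ K', (∀ k, K' k ⊆ {p | p ∉ B ∨ ∃ k < r, p = x k}) ∧ IsWheelModel F h K' := by
  have hi : ∀ {i k m}, HasPass B v a₁ b₁ a₂ b₂ i (K k ∪ K m) → i ≠ i₀ := by
    rintro i k m hi rfl
    rcases hi.terminal_mem with h | h <;> exact hi₀ _ h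
  -- A damaged bag or rim edge avoiding `l` uses both available passes; a neighbour `n` of `l` needs
  -- one of them together with `l`, so `n` must be part of the damage.
  have hnear : ∀ n, (SimpleGraph.cycleGraph 7).Adj n l → ∀ k m, k ≠ l → m ≠ l →
      ∀ i j, i ≠ j → HasPass B v a₁ b₁ a₂ b₂ i (K k ∪ K m) →
      HasPass B v a₁ b₁ a₂ b₂ j (K k ∪ K m) → n = k ∨ n = m := by
    intro n hn k m hk hm i j hij h1 h2
    obtain ⟨y, hy, hyB, -⟩ := hQ n hn.ne
    obtain ⟨z, hz, hzB⟩ := hl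
    obtain ⟨s, hs, t, ht, hst⟩ := hM.rim n l hn
    obtain ⟨i', hi'⟩ := S.exists_pass ((hM.conn n).union (hM.conn l) hs ht (Or.inr hst))
      (Or.inl hy) hyB (Or.inr hz) hzB
    have n1 := hi h1
    have n2 := hi h2
    have n3 := hi hi'
    have : i' = i ∨ i' = j := by omega
    have hcom : n = k ∨ n = m ∨ l = k ∨ l = m := by
      rcases this with rfl | rfl
      · exact hM.exists_common hi'.terminal_mem h1.terminal_mem
      · exact hM.exists_common hi'.terminal_mem h2.terminal_mem
    rcases hcom with h | h | h | h
    · exact Or.inl h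
    · exact Or.inr h
    · exact absurd h.symm hk
    · exact absurd h.symm hm
  have hone : ∀ k m, k ≠ l → m ≠ l → (k = m ∨ (SimpleGraph.cycleGraph 7).Adj k m) →
      ∀ i j, HasPass B v a₁ b₁ a₂ b₂ i (K k ∪ K m) →
      HasPass B v a₁ b₁ a₂ b₂ j (K k ∪ K m) → i = j := by
    intro k m hk hm hkm i j h1 h2
    by_contra hij
    have hp : (SimpleGraph.cycleGraph 7).Adj (l + 1) l := (cycleGraph_seven_adj _ _).2 (Or.inr rfl)
    have hn : (SimpleGraph.cycleGraph 7).Adj (l - 1) l :=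
      (cycleGraph_seven_adj _ _).2 (Or.inl (by simp))
    -- Both neighbours of `l` would lie in one bag or rim edge, but they are distinct and not
    -- adjacent.
    have h3 := hnear _ hp k m hk hm i j hij h1 h2
    have h4 := hnear _ hn k m hk hm i j hij h1 h2
    rw [cycleGraph_seven_adj] at hkm
    revert h3 h4 hkm
    clear * -
    revert k m l
    decide
  obtain ⟨h1, h2⟩ := hM.survive S (P := fun a => a ≠ l) hQ hone
  exact hM.replace_of_receiver S R hh l h1 h2

end Receiver

/-! ### Two or three bags share the new path -/

set_option synthInstance.maxHeartbeats 400000 in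
set_option synthInstance.maxSize 2000 in
set_option maxRecDepth 100000 in
-- Here `c` and `d` stand for the bags containing `a₁` and `a₂`. If every outside neighbour of `k`
-- or `l` needs one of the two passes, then `a₁` serves only `k`, `a₂` serves only `l`, and no other
-- bag or rim edge is damaged.
theorem cycleGraph_seven_two (k l n m c d : Fin 7) (hkl : k ≠ l)
    (hkn : n = k + 1 ∨ k = n + 1) (hlm : m = l + 1 ∨ l = m + 1) (hnm : n ≠ m)
    (hnl : n ≠ l) (hmk : m ≠ k) (hc : c = k ∨ c = n) (hd : d = l ∨ d = m)
    (hk : ∀ e, e ≠ k → e ≠ l → e = k + 1 ∨ k = e + 1 → c = k ∨ c = e ∨ d = k ∨ d = e)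
    (hl : ∀ e, e ≠ k → e ≠ l → e = l + 1 ∨ l = e + 1 → c = l ∨ c = e ∨ d = l ∨ d = e) :
    (∀ e, e ≠ k → e ≠ l → e = k + 1 ∨ k = e + 1 → d ≠ k ∧ d ≠ e) ∧
    (∀ e, e ≠ k → e ≠ l → e = l + 1 ∨ l = e + 1 → c ≠ l ∧ c ≠ e) ∧
    ∀ e f, e ≠ k → e ≠ l → f ≠ k → f ≠ l → e = f ∨ f = e + 1 ∨ e = f + 1 →
      ¬ ((c = e ∨ c = f) ∧ (d = e ∨ d = f)) := by
  -- Solved for `n` and `m`, so that these can be eliminated and the check runs over `k` and `l`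
  -- alone.
  have hkn' : n = k + 1 ∨ n = k - 1 := hkn.imp_right fun h => by rw [h]; simp
  have hlm' : m = l + 1 ∨ m = l - 1 := hlm.imp_right fun h => by rw [h]; simp
  clear hkn hlm
  rcases hkn' with rfl | rfl <;> rcases hlm' with rfl | rfl <;> rcases hc with rfl | rfl <;>
    rcases hd with rfl | rfl <;> revert hkl hnm hnl hmk hk hl <;> decide +revert

set_option synthInstance.maxHeartbeats 400000 in
set_option synthInstance.maxSize 2000 in
set_option maxRecDepth 100000 in
-- The first three cases are arcs with middle `l`, `k`, `m`. Any other triple has distinct outside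
-- neighbours, which would demand three passes.
theorem cycleGraph_seven_three (k l m : Fin 7) (hkl : k ≠ l) (hkm : k ≠ m) (hlm : l ≠ m) :
    ((l = k + 1 ∨ k = l + 1) ∧ (m = l + 1 ∨ l = m + 1)) ∨
    ((l = k + 1 ∨ k = l + 1) ∧ (m = k + 1 ∨ k = m + 1)) ∨
    ((m = k + 1 ∨ k = m + 1) ∧ (m = l + 1 ∨ l = m + 1)) ∨
    ∃ a, (a = k + 1 ∨ k = a + 1) ∧ a ≠ l ∧ a ≠ m ∧ ∃ b, (b = l + 1 ∨ l = b + 1) ∧ b ≠ k ∧ b ≠ m ∧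
      a ≠ b ∧ ∃ c, (c = m + 1 ∨ m = c + 1) ∧ c ≠ k ∧ c ≠ l ∧ a ≠ c ∧ b ≠ c := by
  revert k l m
  decide

/-- `n` and `p` continue the arc at its two ends; two further vertices of the cycle keep them apart.
-/
theorem cycleGraph_seven_arc (k l m : Fin 7) (hkm : k ≠ m) (hkl : l = k + 1 ∨ k = l + 1)
    (hlm : m = l + 1 ∨ l = m + 1) :
    ∃ n p, (n = k + 1 ∨ k = n + 1) ∧ (p = m + 1 ∨ m = p + 1) ∧ n ≠ p ∧
      ¬ (p = n + 1 ∨ n = p + 1) ∧ n ≠ l ∧ n ≠ m ∧ p ≠ k ∧ p ≠ l ∧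
      (∀ e, e = k + 1 ∨ k = e + 1 → e = l ∨ e = n) ∧
      (∀ e, e = m + 1 ∨ m = e + 1 → e = l ∨ e = p) ∧
      ∀ e, e = l + 1 ∨ l = e + 1 → e = k ∨ e = m := by
  revert k l m
  decide

theorem cycleGraph_seven_private (k l : Fin 7) (hkl : k ≠ l) :
    ∃ n m, (n = k + 1 ∨ k = n + 1) ∧ (m = l + 1 ∨ l = m + 1) ∧ n ≠ m ∧ n ≠ l ∧ m ≠ k := by
  revert k l
  decide

section Sharing

variable {V : Type*} {G F : SimpleGraph V} {A B : Set V} {v a₁ b₁ a₂ b₂ : V} {r : ℕ} {x : ℕ → V}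

theorem IsReplaced.exists_adj_terminal_first (R : IsReplaced G F B v a₁ a₂ r x) {j : Fin 3}
    (hj : j = 0) : ∃ z ∈ ({x 0} : Set V), F.Adj (cutTerminal v a₁ a₂ j) z := by
  subst hj
  exact ⟨x 0, rfl, R.adj_first⟩

theorem IsReplaced.exists_adj_terminal_last (R : IsReplaced G F B v a₁ a₂ r x) {s : ℕ}
    (hs : s < r) {j : Fin 3} (hj : j = 1) :
    ∃ z ∈ {p | ∃ k, s ≤ k ∧ k < r ∧ p = x k}, F.Adj (cutTerminal v a₁ a₂ j) z := by
  subst hj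
  exact ⟨x (r - 1), ⟨r - 1, by omega, by omega, rfl⟩, R.adj_last⟩

theorem IsWheelModel.exists_pass_of_boundary (S : IsSplit G A B v a₁ b₁ a₂ b₂)
    {K : Fin 7 → Set V} (hM : IsWheelModel G v K) {k n : Fin 7}
    (hkn : n = k + 1 ∨ k = n + 1) (hk : ∃ y ∈ K k, y ∈ B)
    (hn : ∃ y ∈ K n, y ∉ B ∧ G.Adj v y) : ∃ j, HasPass B v a₁ b₁ a₂ b₂ j (K k ∪ K n) := by
  obtain ⟨s, hs, t, ht, hst⟩ := hM.rim k n ((cycleGraph_seven_adj _ _).2 hkn)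
  obtain ⟨y, hy, hyB⟩ := hk
  obtain ⟨z, hz, hzB, -⟩ := hn
  exact S.exists_pass ((hM.conn k).union (hM.conn n) hs ht (Or.inr hst)) (Or.inr hz) hzB
    (Or.inl hy) hyB

/-- The hub `v` lies in no bag, so only the passes along the two cut edges remain. -/
theorem IsWheelModel.pass_ne_two {K : Fin 7 → Set V} (hM : IsWheelModel G v K) {k n : Fin 7}
    {j : Fin 3} (hj : HasPass B v a₁ b₁ a₂ b₂ j (K k ∪ K n)) : j ≠ 2 := by
  rintro rfl
  rcases hj.1 with h | h <;> exact hM.hub _ h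

/-- If exactly two bags have no neighbour of the hub `v` outside `B`, they share the new path. -/
theorem IsWheelModel.replace_of_two (S : IsSplit G A B v a₁ b₁ a₂ b₂)
    (R : IsReplaced G F B v a₁ a₂ r x) {K : Fin 7 → Set V} (hM : IsWheelModel G v K)
    {k l : Fin 7} (hkl : k ≠ l) (hk : ∃ y ∈ K k, y ∈ B) (hl : ∃ y ∈ K l, y ∈ B)
    (hQ : ∀ a, a ≠ k ∧ a ≠ l → ∃ y ∈ K a, y ∉ B ∧ G.Adj v y) (hr : 2 ≤ r) :
    ∃ K', (∀ k, K' k ⊆ {p | p ∉ B ∨ ∃ k < r, p = x k}) ∧ IsWheelModel F v K' := by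
  classical
  obtain ⟨n, m, hkn, hlm, hnm, hnl, hmk⟩ := cycleGraph_seven_private k l hkl
  have hnk : n ≠ k := ((cycleGraph_seven_adj _ _).2 hkn).ne'
  have hml : m ≠ l := ((cycleGraph_seven_adj _ _).2 hlm).ne'
  obtain ⟨i, hi⟩ := hM.exists_pass_of_boundary S hkn hk (hQ n ⟨hnk, hnl⟩)
  obtain ⟨j, hj⟩ := hM.exists_pass_of_boundary S hlm hl (hQ m ⟨hmk, hml⟩)
  -- The pairs `k, n` and `l, m` have no bag in common, so they cannot use the same terminal.
  have hij : i ≠ j := by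
    rintro rfl
    rcases hM.exists_common hi.terminal_mem hj.terminal_mem with h | h | h | h
    · exact hkl h
    · exact hmk h.symm
    · exact hnl h
    · exact hnm h
  have hi2 := hM.pass_ne_two hi
  have hj2 := hM.pass_ne_two hj
  -- Exchanging `k` and `l` if necessary, `k` uses the pass at `a₁`, the end where the new path
  -- begins.
  wlog hi0 : i = 0 generalizing k l n m i j
  · exact this hkl.symm hl hk (fun a ha => hQ a ha.symm) m n hlm hkn hnm.symm hmk hnl hml hnk
      j hj i hi hij.symm hj2 hi2 (by omega)
  obtain rfl : j = 1 := by omega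
  subst hi0
  have hc : ∃ c, (c = k ∨ c = n) ∧ cutTerminal v a₁ a₂ 0 ∈ K c := by
    rcases hi.terminal_mem with h | h
    · exact ⟨k, Or.inl rfl, h⟩
    · exact ⟨n, Or.inr rfl, h⟩
  have hd : ∃ d, (d = l ∨ d = m) ∧ cutTerminal v a₁ a₂ 1 ∈ K d := by
    rcases hj.terminal_mem with h | h
    · exact ⟨l, Or.inl rfl, h⟩
    · exact ⟨m, Or.inr rfl, h⟩
  obtain ⟨c, hc, hcK⟩ := hc
  obtain ⟨d, hd, hdK⟩ := hd
  have h0 : ∀ {a b}, HasPass B v a₁ b₁ a₂ b₂ 0 (K a ∪ K b) → c = a ∨ c = b := by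
    intro a b h
    rcases hM.exists_common (k := c) (m := c) (Or.inl hcK) h.terminal_mem with h | h | h | h
    exacts [Or.inl h, Or.inr h, Or.inl h, Or.inr h]
  have h1 : ∀ {a b}, HasPass B v a₁ b₁ a₂ b₂ 1 (K a ∪ K b) → d = a ∨ d = b := by
    intro a b h
    rcases hM.exists_common (k := d) (m := d) (Or.inl hdK) h.terminal_mem with h | h | h | h
    exacts [Or.inl h, Or.inr h, Or.inl h, Or.inr h]
  have h01 : ∀ {a b j}, HasPass B v a₁ b₁ a₂ b₂ j (K a ∪ K b) → j = 0 ∨ j = 1 := by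
    intro a b j h
    have := hM.pass_ne_two h
    omega
  have hbd : ∀ a b, (b = a + 1 ∨ a = b + 1) → (∃ y ∈ K a, y ∈ B) → b ≠ k → b ≠ l →
      c = a ∨ c = b ∨ d = a ∨ d = b := by
    intro a b hab ha hbk hbl
    obtain ⟨j, hj⟩ := hM.exists_pass_of_boundary S hab ha (hQ b ⟨hbk, hbl⟩)
    rcases h01 hj with rfl | rfl
    · exact (h0 hj).imp_right Or.inl
    · exact Or.inr (Or.inr (h1 hj))
  obtain ⟨hkd, hlc, hnone⟩ := cycleGraph_seven_two k l n m c d hkl hkn hlm hnm hnl hmk hc hd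
    (fun e hek hel h => hbd k e h hk hek hel) (fun e hek hel h => hbd l e h hl hek hel)
  have hk0 : ∀ e, e ≠ k → e ≠ l → (e = k + 1 ∨ k = e + 1) → ∀ j,
      HasPass B v a₁ b₁ a₂ b₂ j (K k ∪ K e) → j = 0 := by
    intro e hek hel hke j hj
    refine (h01 hj).resolve_right ?_
    rintro rfl
    obtain ⟨n1, n2⟩ := hkd e hek hel hke
    rcases h1 hj with h | h
    · exact n1 h
    · exact n2 h
  have hl1 : ∀ e, e ≠ k → e ≠ l → (e = l + 1 ∨ l = e + 1) → ∀ j,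
      HasPass B v a₁ b₁ a₂ b₂ j (K l ∪ K e) → j = 1 := by
    intro e hek hel hle j hj
    refine (h01 hj).resolve_left ?_
    rintro rfl
    obtain ⟨n1, n2⟩ := hlc e hek hel hle
    rcases h0 hj with h | h
    · exact n1 h
    · exact n2 h
  obtain ⟨hN, hNN⟩ := hM.survive S hQ (by
    intro e f he hf hef i j hi hj
    have hef' : e = f ∨ f = e + 1 ∨ e = f + 1 := hef.imp_right (cycleGraph_seven_adj _ _).1
    have := hnone e f he.1 he.2 hf.1 hf.2 hef'
    rcases h01 hi with rfl | rfl <;> rcases h01 hj with rfl | rfl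
    · rfl
    · exact absurd ⟨h0 hi, h1 hj⟩ this
    · exact absurd ⟨h0 hj, h1 hi⟩ this
    · rfl)
  -- `k` takes `x 0`, adjacent to `a₁`; `l` takes all the rest, so that it reaches the last vertex,
  -- adjacent to `a₂`, even when `r = 3`.
  obtain ⟨Y, hYk, hYl, hYn⟩ : ∃ Y : Fin 7 → Set V, Y k = {x 0} ∧
      Y l = {p | ∃ k, 1 ≤ k ∧ k < r ∧ p = x k} ∧ ∀ a, a ≠ k ∧ a ≠ l → Y a = ∅ :=
    ⟨fun a => if a = k then {x 0} else if a = l then {p | ∃ k, 1 ≤ k ∧ k < r ∧ p = x k} else ∅,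
      if_pos rfl, by simp [hkl.symm], fun a ha => by simp [ha.1, ha.2]⟩
  have hYkne : (Y k).Nonempty := hYk ▸ Set.singleton_nonempty _
  have hYlne : (Y l).Nonempty := hYl ▸ (R.connOn_segment (s := 1) (by omega)).1
  have hYne : ∀ a, (Y a).Nonempty → a = k ∨ a = l := by
    intro a ha
    by_contra hcon
    rw [hYn a (not_or.1 hcon)] at ha
    exact Set.not_nonempty_empty ha
  have hYnne : ∀ a, ¬ (Y a).Nonempty → a ≠ k ∧ a ≠ l := by
    intro a ha
    exact ⟨fun h => ha (h ▸ hYkne), fun h => ha (h ▸ hYlne)⟩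
  have hYkl : ∀ z ∈ Y k, z ∉ Y l := by
    intro z hz hz'
    rw [hYk] at hz
    rw [hYl] at hz'
    obtain rfl : z = x 0 := hz
    obtain ⟨s, hs, hsr, he⟩ := hz'
    have := R.inj 0 R.pos s hsr he
    omega
  have hYkl' : ∃ y ∈ Y k, ∃ z ∈ Y l, F.Adj y z := by
    rw [hYk, hYl]
    exact ⟨x 0, rfl, x 1, ⟨1, le_rfl, hr, rfl⟩, R.adj_step 0 hr⟩
  refine hM.distribute S R S.v_B Y ?_ ?_ ?_ ?_ (fun a ha => hN a (hYnne a ha))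
    (fun a b ha hb => hNN a b (hYnne a ha) (hYnne b hb))
  · intro a z hz
    rcases hYne a ⟨z, hz⟩ with rfl | rfl
    · rw [hYk] at hz
      exact ⟨0, R.pos, hz⟩
    · rw [hYl] at hz
      obtain ⟨s, -, hs, h⟩ := hz
      exact ⟨s, hs, h⟩
  · intro a b hab z hz hz'
    rcases hYne a ⟨z, hz⟩ with rfl | rfl <;> rcases hYne b ⟨z, hz'⟩ with rfl | rfl
    · exact hab rfl
    · exact hYkl z hz hz'
    · exact hYkl z hz' hz
    · exact hab rfl
  · intro a ha
    rcases hYne a ha with rfl | rfl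
    · rw [hYk]
      refine ⟨.singleton _, Or.inl hk, ⟨x 0, Or.inr rfl, R.adj_v 0 R.pos⟩, fun j hj => ?_,
        fun e he hae j hj => ?_⟩
      · exact R.exists_adj_terminal_first (hk0 n hnk hnl hkn j (hj.mono Set.subset_union_left))
      · obtain ⟨n1, n2⟩ := hYnne e he
        exact R.exists_adj_terminal_first
          (hk0 e n1 n2 ((cycleGraph_seven_adj _ _).1 hae) j hj)
    · rw [hYl]
      refine ⟨R.connOn_segment (by omega), Or.inl hl, ⟨x 1, Or.inr ⟨1, le_rfl, hr, rfl⟩,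
        R.adj_v 1 hr⟩, fun j hj => ?_, fun e he hae j hj => ?_⟩
      · exact R.exists_adj_terminal_last (by omega)
          (hl1 m hmk hml hlm j (hj.mono Set.subset_union_left))
      · obtain ⟨n1, n2⟩ := hYnne e he
        exact R.exists_adj_terminal_last (by omega)
          (hl1 e n1 n2 ((cycleGraph_seven_adj _ _).1 hae) j hj)
  · intro a b ha hb hab
    rcases hYne a ha with rfl | rfl <;> rcases hYne b hb with rfl | rfl
    · exact absurd rfl hab.ne
    · exact hYkl'
    · obtain ⟨y, hy, z, hz, hyz⟩ := hYkl'
      exact ⟨z, hz, y, hy, hyz.symm⟩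
    · exact absurd rfl hab.ne

/-- If exactly three consecutive bags have no neighbour of the hub `v` outside `B`, they share the
new path. -/
theorem IsWheelModel.replace_of_arc (S : IsSplit G A B v a₁ b₁ a₂ b₂)
    (R : IsReplaced G F B v a₁ a₂ 3 x) {K : Fin 7 → Set V} (hM : IsWheelModel G v K)
    {k l m : Fin 7} (hkm : k ≠ m) (hkl : l = k + 1 ∨ k = l + 1) (hlm : m = l + 1 ∨ l = m + 1)
    (hk : ∃ y ∈ K k, y ∈ B) (hl : ∃ y ∈ K l, y ∈ B) (hm : ∃ y ∈ K m, y ∈ B)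
    (hQ : ∀ a, a ≠ k ∧ a ≠ l ∧ a ≠ m → ∃ y ∈ K a, y ∉ B ∧ G.Adj v y) :
    ∃ K', (∀ k, K' k ⊆ {p | p ∉ B ∨ ∃ k < 3, p = x k}) ∧ IsWheelModel F v K' := by
  classical
  obtain ⟨n, p, hkn, hmp, hnp, hnp', hnl, hnm, hpk, hpl, hNk, hNm, hNl⟩ :=
    cycleGraph_seven_arc k l m hkm hkl hlm
  have hnk : n ≠ k := ((cycleGraph_seven_adj _ _).2 hkn).ne'
  have hpm : p ≠ m := ((cycleGraph_seven_adj _ _).2 hmp).ne'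
  have hlk : l ≠ k := ((cycleGraph_seven_adj _ _).2 hkl).ne'
  have hml : m ≠ l := ((cycleGraph_seven_adj _ _).2 hlm).ne'
  obtain ⟨i, hi⟩ := hM.exists_pass_of_boundary S hkn hk (hQ n ⟨hnk, hnl, hnm⟩)
  obtain ⟨j, hj⟩ := hM.exists_pass_of_boundary S hmp hm (hQ p ⟨hpk, hpl, hpm⟩)
  have hij : i ≠ j := by
    rintro rfl
    rcases hM.exists_common hi.terminal_mem hj.terminal_mem with h | h | h | h
    · exact hkm h
    · exact hpk h.symm
    · exact hnm h
    · exact hnp h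
  have hi2 := hM.pass_ne_two hi
  have hj2 := hM.pass_ne_two hj
  wlog hi0 : i = 0 generalizing k m n p i j
  · exact this hkm.symm hlm.symm hkl.symm hm hk (fun a ha => hQ a ⟨ha.2.2, ha.2.1, ha.1⟩)
      p n hmp hkn hnp.symm (fun h => hnp' h.symm) hpl hpk hnm hnl hNm hNk
      (fun e he => (hNl e he).symm) hpm hnk hml.symm hlk.symm j hj i hi hij.symm hj2 hi2 (by omega)
  obtain rfl : j = 1 := by omega
  subst hi0
  have h01 : ∀ {a b j}, HasPass B v a₁ b₁ a₂ b₂ j (K a ∪ K b) → j = 0 ∨ j = 1 := by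
    intro a b j h
    have := hM.pass_ne_two h
    omega
  have h0 : ∀ {a b}, HasPass B v a₁ b₁ a₂ b₂ 0 (K a ∪ K b) → k = a ∨ k = b ∨ n = a ∨ n = b :=
    fun h => hM.exists_common hi.terminal_mem h.terminal_mem
  have h1 : ∀ {a b}, HasPass B v a₁ b₁ a₂ b₂ 1 (K a ∪ K b) → m = a ∨ m = b ∨ p = a ∨ p = b :=
    fun h => hM.exists_common hj.terminal_mem h.terminal_mem
  have hk0 : ∀ j, HasPass B v a₁ b₁ a₂ b₂ j (K k ∪ K n) → j = 0 := by
    intro j hj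
    refine (h01 hj).resolve_right ?_
    rintro rfl
    rcases h1 hj with h | h | h | h
    · exact hkm h.symm
    · exact hnm h.symm
    · exact hpk h
    · exact hnp h.symm
  have hm1 : ∀ j, HasPass B v a₁ b₁ a₂ b₂ j (K m ∪ K p) → j = 1 := by
    intro j hj
    refine (h01 hj).resolve_left ?_
    rintro rfl
    rcases h0 hj with h | h | h | h
    · exact hkm h
    · exact hpk h.symm
    · exact hnm h
    · exact hnp h
  obtain ⟨hN, hNN⟩ := hM.survive S hQ (by
    intro e f he hf hef i j hi hj
    have key : HasPass B v a₁ b₁ a₂ b₂ 0 (K e ∪ K f) →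
        HasPass B v a₁ b₁ a₂ b₂ 1 (K e ∪ K f) → False := by
      intro h h'
      have e1 : n = e ∨ n = f := by
        rcases h0 h with h | h | h
        · exact absurd h.symm he.1
        · exact absurd h.symm hf.1
        · exact h
      have e2 : p = e ∨ p = f := by
        rcases h1 h' with h | h | h
        · exact absurd h.symm he.2.2
        · exact absurd h.symm hf.2.2
        · exact h
      rw [cycleGraph_seven_adj] at hef
      rcases e1 with rfl | rfl <;> rcases e2 with rfl | rfl
      · exact hnp rfl
      · exact hef.elim hnp hnp'
      · exact hef.elim hnp.symm fun h => hnp' h.symm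
      · exact hnp rfl
    rcases h01 hi with rfl | rfl <;> rcases h01 hj with rfl | rfl
    · rfl
    · exact (key hi hj).elim
    · exact (key hj hi).elim
    · rfl)
  -- The new path is laid along the arc: each end bag gets the vertex adjacent to its own terminal,
  -- and the middle bag gets `x 1`.
  obtain ⟨Y, hYk, hYl, hYm, hYn⟩ : ∃ Y : Fin 7 → Set V, Y k = {x 0} ∧ Y l = {x 1} ∧
      Y m = {x 2} ∧ ∀ a, a ≠ k ∧ a ≠ l ∧ a ≠ m → Y a = ∅ :=
    ⟨fun a => if a = k then {x 0} else if a = l then {x 1} else if a = m then {x 2} else ∅,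
      if_pos rfl, by simp [hlk], by simp [hkm.symm, hml],
      fun a ha => by simp [ha.1, ha.2.1, ha.2.2]⟩
  have hYne : ∀ a, (Y a).Nonempty → a = k ∨ a = l ∨ a = m := by
    intro a ha
    by_contra hcon
    rw [not_or, not_or] at hcon
    rw [hYn a hcon] at ha
    exact Set.not_nonempty_empty ha
  have hYnne : ∀ a, ¬ (Y a).Nonempty → a ≠ k ∧ a ≠ l ∧ a ≠ m := by
    intro a ha
    refine ⟨?_, ?_, ?_⟩
    · rintro rfl; exact ha (hYk ▸ Set.singleton_nonempty _)
    · rintro rfl; exact ha (hYl ▸ Set.singleton_nonempty _)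
    · rintro rfl; exact ha (hYm ▸ Set.singleton_nonempty _)
  have hYidx : ∀ a, (Y a).Nonempty → ∃ s < 3, Y a = {x s} ∧
      ((a = k ∧ s = 0) ∨ (a = l ∧ s = 1) ∨ (a = m ∧ s = 2)) := by
    intro a ha
    rcases hYne a ha with rfl | rfl | rfl
    · exact ⟨0, by omega, hYk, by simp⟩
    · exact ⟨1, by omega, hYl, by simp⟩
    · exact ⟨2, by omega, hYm, by simp⟩
  refine hM.distribute S R S.v_B Y ?_ ?_ ?_ ?_ (fun a ha => hN a (hYnne a ha))
    (fun a b ha hb => hNN a b (hYnne a ha) (hYnne b hb))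
  · intro a z hz
    obtain ⟨s, hs, hYs, -⟩ := hYidx a ⟨z, hz⟩
    rw [hYs] at hz
    exact ⟨s, hs, hz⟩
  · intro a b hab z hz hz'
    obtain ⟨s, hs, hYs, has⟩ := hYidx a ⟨z, hz⟩
    obtain ⟨t, ht, hYt, hbt⟩ := hYidx b ⟨z, hz'⟩
    rw [hYs] at hz
    rw [hYt] at hz'
    have hst : s = t := R.inj s hs t ht ((show z = x s from hz).symm.trans hz')
    subst hst
    rcases has with ⟨h, h'⟩ | ⟨h, h'⟩ | ⟨h, h'⟩ <;> rcases hbt with ⟨g, g'⟩ | ⟨g, g'⟩ | ⟨g, g'⟩ <;>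
      first | exact hab (h.trans g.symm) | omega
  · intro a ha
    rcases hYne a ha with rfl | rfl | rfl
    · rw [hYk]
      refine ⟨.singleton _, Or.inl hk, ⟨x 0, Or.inr rfl, R.adj_v 0 (by omega)⟩, fun j hj => ?_,
        fun e he hae j hj => ?_⟩
      · exact R.exists_adj_terminal_first (hk0 j (hj.mono Set.subset_union_left))
      · rcases hNk e ((cycleGraph_seven_adj _ _).1 hae) with rfl | rfl
        · exact absurd rfl (hYnne _ he).2.1
        · exact R.exists_adj_terminal_first (hk0 j hj)
    · rw [hYl]
      refine ⟨.singleton _, Or.inl hl, ⟨x 1, Or.inr rfl, R.adj_v 1 (by omega)⟩, fun j hj => ?_,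
        fun e he hae j hj => ?_⟩
      -- The middle bag has no pass at all: `a₁` lies in `K k ∪ K n` and `a₂` in `K m ∪ K p`.
      · have hj' := hj.mono (Set.subset_union_left (t := K a))
        rcases h01 hj' with rfl | rfl
        · rcases h0 hj' with h | h | h | h
          · exact absurd h.symm hlk
          · exact absurd h.symm hlk
          · exact absurd h hnl
          · exact absurd h hnl
        · rcases h1 hj' with h | h | h | h
          · exact absurd h hml
          · exact absurd h hml
          · exact absurd h hpl
          · exact absurd h hpl
      · rcases hNl e ((cycleGraph_seven_adj _ _).1 hae) with rfl | rfl
        · exact absurd rfl (hYnne _ he).1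
        · exact absurd rfl (hYnne _ he).2.2
    · have hlast : ∀ j, j = 1 → ∃ z ∈ ({x 2} : Set V), F.Adj (cutTerminal v a₁ a₂ j) z := by
        rintro j rfl
        exact ⟨x 2, rfl, R.adj_last⟩
      rw [hYm]
      refine ⟨.singleton _, Or.inl hm, ⟨x 2, Or.inr rfl, R.adj_v 2 (by omega)⟩, fun j' hj' => ?_,
        fun e he hae j' hj' => ?_⟩
      · exact hlast j' (hm1 j' (hj'.mono Set.subset_union_left))
      · rcases hNm e ((cycleGraph_seven_adj _ _).1 hae) with rfl | rfl
        · exact absurd rfl (hYnne _ he).2.1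
        · exact hlast j' (hm1 j' hj')
  · intro a b ha hb hab
    have hkm' : ¬ (SimpleGraph.cycleGraph 7).Adj k m := fun h =>
      cycleGraph_seven_no_triangle k l m ((cycleGraph_seven_adj _ _).2 hkl)
        ((cycleGraph_seven_adj _ _).2 hlm) h
    have e01 := R.adj_step 0 (by omega)
    have e12 := R.adj_step 1 (by omega)
    rcases hYne a ha with rfl | rfl | rfl <;> rcases hYne b hb with rfl | rfl | rfl
    · exact absurd rfl hab.ne
    · rw [hYk, hYl]; exact ⟨_, rfl, _, rfl, e01⟩
    · exact absurd hab hkm'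
    · rw [hYk, hYl]; exact ⟨_, rfl, _, rfl, e01.symm⟩
    · exact absurd rfl hab.ne
    · rw [hYl, hYm]; exact ⟨_, rfl, _, rfl, e12⟩
    · exact absurd hab.symm hkm'
    · rw [hYl, hYm]; exact ⟨_, rfl, _, rfl, e12.symm⟩
    · exact absurd rfl hab.ne

/-- If the three bags are not consecutive, three disjoint pairs of bags each need a pass, but only
two passes avoid the hub. -/
theorem IsWheelModel.replace_of_three (S : IsSplit G A B v a₁ b₁ a₂ b₂)
    (R : IsReplaced G F B v a₁ a₂ 3 x) {K : Fin 7 → Set V} (hM : IsWheelModel G v K)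
    {k l m : Fin 7} (hkl : k ≠ l) (hkm : k ≠ m) (hlm : l ≠ m)
    (hk : ∃ y ∈ K k, y ∈ B) (hl : ∃ y ∈ K l, y ∈ B) (hm : ∃ y ∈ K m, y ∈ B)
    (hQ : ∀ a, a ≠ k ∧ a ≠ l ∧ a ≠ m → ∃ y ∈ K a, y ∉ B ∧ G.Adj v y) :
    ∃ K', (∀ k, K' k ⊆ {p | p ∉ B ∨ ∃ k < 3, p = x k}) ∧ IsWheelModel F v K' := by
  rcases cycleGraph_seven_three k l m hkl hkm hlm with ⟨h, h'⟩ | ⟨h, h'⟩ | ⟨h, h'⟩ |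
    ⟨a, ha, hal, ham, b, hb, hbk, hbm, hab, c, hc, hck, hcl, hac, hbc⟩
  · exact hM.replace_of_arc S R hkm h h' hk hl hm hQ
  · exact hM.replace_of_arc S R hlm h.symm h' hl hk hm fun a ha => hQ a ⟨ha.2.1, ha.1, ha.2.2⟩
  · exact hM.replace_of_arc S R hkl h h'.symm hk hm hl fun a ha => hQ a ⟨ha.1, ha.2.2, ha.2.1⟩
  · exfalso
    have hak : a ≠ k := ((cycleGraph_seven_adj _ _).2 ha).ne'
    have hbl : b ≠ l := ((cycleGraph_seven_adj _ _).2 hb).ne'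
    have hcm : c ≠ m := ((cycleGraph_seven_adj _ _).2 hc).ne'
    obtain ⟨i₁, h₁⟩ := hM.exists_pass_of_boundary S ha hk (hQ a ⟨hak, hal, ham⟩)
    obtain ⟨i₂, h₂⟩ := hM.exists_pass_of_boundary S hb hl (hQ b ⟨hbk, hbl, hbm⟩)
    obtain ⟨i₃, h₃⟩ := hM.exists_pass_of_boundary S hc hm (hQ c ⟨hck, hcl, hcm⟩)
    have n1 := hM.pass_ne_two h₁
    have n2 := hM.pass_ne_two h₂
    have n3 := hM.pass_ne_two h₃
    have : i₁ = i₂ ∨ i₁ = i₃ ∨ i₂ = i₃ := by omega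
    rcases this with rfl | rfl | rfl
    · rcases hM.exists_common h₁.terminal_mem h₂.terminal_mem with h | h | h | h
      · exact hkl h
      · exact hbk h.symm
      · exact hal h
      · exact hab h
    · rcases hM.exists_common h₁.terminal_mem h₃.terminal_mem with h | h | h | h
      · exact hkm h
      · exact hck h.symm
      · exact ham h
      · exact hac h
    · rcases hM.exists_common h₂.terminal_mem h₃.terminal_mem with h | h | h | h
      · exact hlm h
      · exact hcl h.symm
      · exact hbm h
      · exact hbc h

/-- A model whose hub is not in `B` can be rerouted, if at most three bags have all their
neighbours of the hub in `B`. -/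
theorem IsWheelModel.replace (S : IsSplit G A B v a₁ b₁ a₂ b₂)
    (R : IsReplaced G F B v a₁ a₂ r x) {h : V} {K : Fin 7 → Set V} (hM : IsWheelModel G h K)
    (hh : h ∉ B) (Q : Finset (Fin 7)) (hQ : ∀ a, a ∈ Q ↔ ¬ ∃ y ∈ K a, y ∉ B ∧ G.Adj h y)
    (hQ3 : h = v → Q.card ≤ 3) :
    ∃ K', (∀ k, K' k ⊆ {p | p ∉ B ∨ ∃ k < r, p = x k}) ∧ IsWheelModel F h K' := by
  have hin : ∀ a ∈ Q, ∃ y ∈ K a, y ∈ B ∧ G.Adj h y := by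
    intro a ha
    obtain ⟨y, hy, hhy⟩ := hM.spoke a
    refine ⟨y, hy, ?_, hhy⟩
    by_contra hyB
    exact (hQ a).1 ha ⟨y, hy, hyB, hhy⟩
  have hout : ∀ a, a ∉ Q → ∃ y ∈ K a, y ∉ B ∧ G.Adj h y := fun a ha => by
    by_contra hcon
    exact ha ((hQ a).2 hcon)
  have hinB : ∀ a ∈ Q, ∃ y ∈ K a, y ∈ B := fun a ha => by
    obtain ⟨y, hy, hyB, -⟩ := hin a ha
    exact ⟨y, hy, hyB⟩
  rcases Q.eq_empty_or_nonempty with rfl | hne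
  · exact hM.replace_of_forall S R hh fun a => hout a (by simp)
  by_cases hcard : Q.card = 1
  · obtain ⟨l, rfl⟩ := Finset.card_eq_one.1 hcard
    -- The hub has a neighbour in `B`, so it is itself a terminal, and that terminal lies in no bag.
    have hi₀ : ∃ i₀, ∀ a, cutTerminal v a₁ a₂ i₀ ∉ K a := by
      obtain ⟨y, hy, hyB, hhy⟩ := hin l (by simp)
      obtain ⟨i, hi, -⟩ := S.exists_pass_of_adj (W := Set.univ) trivial hh trivial hyB hhy
      exact ⟨i, fun a => hi ▸ hM.hub a⟩
    obtain ⟨i₀, hi₀⟩ := hi₀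
    exact hM.replace_of_forall_ne S R hh l (fun a ha => hout a (by simpa using ha))
      (hinB l (by simp)) hi₀
  -- A hub in `A` has at most one neighbour in `B`, which would leave only one bag in `Q`.
  have hhv : h = v := by
    rcases S.cover h with hA | hB | hv
    · exfalso
      apply hcard
      obtain ⟨l, hl⟩ := hne
      refine Finset.card_eq_one.2 ⟨l, Finset.eq_singleton_iff_unique_mem.2 ⟨hl, fun a ha => ?_⟩⟩
      obtain ⟨y, hy, hyB, hhy⟩ := hin l hl
      obtain ⟨z, hz, hzB, hhz⟩ := hin a ha
      by_contra hal
      refine hM.disj a l hal z hz ?_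
      rcases S.cross h hA y hyB hhy with ⟨h1, h2⟩ | ⟨h1, h2⟩ <;>
        rcases S.cross h hA z hzB hhz with ⟨h3, h4⟩ | ⟨h3, h4⟩
      · rwa [h4, ← h2]
      · exact absurd (h1.symm.trans h3) S.a_ne
      · exact absurd (h3.symm.trans h1) S.a_ne
      · rwa [h4, ← h2]
    · exact absurd hB hh
    · exact hv
  subst hhv
  -- The bags of `Q` contain distinct neighbours of `v` in `B`, so the new path has a vertex for
  -- each of them.
  have hQr : Q.card ≤ r := by
    classical
    choose y hy hyB hhy using hin
    let s : Finset V := Q.attach.image fun a => y a.1 a.2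
    have hs : s.card = Q.card := by
      rw [Finset.card_image_of_injective, Finset.card_attach]
      intro a b hab
      by_contra hne
      exact hM.disj a.1 b.1 (fun e => hne (Subtype.ext e)) _ (hy a.1 a.2)
        ((show y a.1 a.2 = y b.1 b.2 from hab) ▸ hy b.1 b.2)
    rw [← hs]
    refine R.many s ?_ (hs ▸ hQ3 rfl)
    intro z hz
    obtain ⟨a, -, rfl⟩ := Finset.mem_image.1 hz
    exact ⟨hyB a.1 a.2, hhy a.1 a.2⟩
  have hQ3 := hQ3 rfl
  have hpos := Finset.card_pos.2 hne
  obtain hc | hc : Q.card = 2 ∨ Q.card = 3 := by omega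
  · obtain ⟨k, l, hkl, rfl⟩ := Finset.card_eq_two.1 hc
    exact hM.replace_of_two S R hkl (hinB k (by simp)) (hinB l (by simp))
      (fun a ha => hout a (by simp [ha.1, ha.2])) (by omega)
  · obtain ⟨k, l, m, hkl, hkm, hlm, rfl⟩ := Finset.card_eq_three.1 hc
    obtain rfl : r = 3 := by have := R.le_three; omega
    exact hM.replace_of_three S R hkl hkm hlm (hinB k (by simp)) (hinB l (by simp))
      (hinB m (by simp)) fun a ha => hout a (by simp [ha.1, ha.2.1, ha.2.2])

end Sharing

/-! ### The equivalence -/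

theorem mainTheorem9 {V : Type*} [Finite V] (G : SimpleGraph V) (hG : IsKConnected G 3)
    (e₁ e₂ : Sym2 V) (v : V) (hS : IsType1EdgeVertexCutset G e₁ e₂ v)
    (G₁ G₂ : (edgeVertexRemoval G e₁ e₂ v).ConnectedComponent) (hne : G₁ ≠ G₂)
    (i j : ℕ) (u : Fin i → V) (w : Fin j → V)
    (hu : Function.Injective u) (hw : Function.Injective w)
    (hu_range : Set.range u = G.neighborSet v ∩ componentVerts G₁)
    (hw_range : Set.range w = G.neighborSet v ∩ componentVerts G₂) :
    ContainsSubdivision (wheelGraph 7) G ↔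
      (ContainsSubdivision (wheelGraph 7) (replaceSide G e₁ e₂ v (componentVerts G₁) w) ∨
        ContainsSubdivision (wheelGraph 7) (replaceSide G e₁ e₂ v (componentVerts G₂) u)) := by
  classical
  obtain ⟨a₁, b₁, a₂, b₂, rfl, rfl, S⟩ := exists_isSplit hG hS hne
  have hpos : ∀ {n : ℕ} (t : Fin n → V)
      {C D : (edgeVertexRemoval G s(a₁, b₁) s(a₂, b₂) v).ConnectedComponent}, C ≠ D →
      Set.range t = G.neighborSet v ∩ componentVerts C → 0 < n := by
    intro n t C D hCD ht
    obtain ⟨p, hp, hvp⟩ := exists_neighbor_mem_componentVerts hG hS hCD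
    have : p ∈ Set.range t := ht ▸ ⟨hvp, hp⟩
    obtain ⟨k, -⟩ := this
    exact k.pos
  obtain ⟨F₁, x, r, R₁, hU₁, hF₁⟩ := exists_isReplaced S (hpos w hne.symm hw_range) w hw hw_range
  obtain ⟨F₂, y, s, R₂, hU₂, hF₂⟩ := exists_isReplaced S.symm (hpos u hne hu_range) u hu hu_range
  rw [Sym2.eq_swap (a := b₁), Sym2.eq_swap (a := b₂)] at hF₂
  rw [hF₁, hF₂, containsSubdivision_wheelGraph_induce_iff,
    containsSubdivision_wheelGraph_induce_iff, containsSubdivision_wheelGraph_iff, ← hU₁, ← hU₂]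
  constructor
  · rintro ⟨h, K, hM⟩
    let Q₁ : Finset (Fin 7) :=
      {a | ¬ ∃ z ∈ K a, z ∉ componentVerts G₂ ∧ G.Adj h z}
    let Q₂ : Finset (Fin 7) :=
      {a | ¬ ∃ z ∈ K a, z ∉ componentVerts G₁ ∧ G.Adj h z}
    -- A neighbour of the hub in a bag cannot lie on both sides, so it excludes the bag from `Q₁` or
    -- from `Q₂`.
    have hQ : Disjoint Q₁ Q₂ := by
      rw [Finset.disjoint_left]
      intro a ha ha'
      simp only [Q₁, Q₂, Finset.mem_filter, Finset.mem_univ, true_and] at ha ha'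
      obtain ⟨z, hz, hhz⟩ := hM.spoke a
      refine ha ⟨z, hz, fun hzB => ha' ⟨z, hz, fun hzA => S.disj z hzA hzB, hhz⟩, hhz⟩
    have hcard : Q₁.card + Q₂.card ≤ 7 := by
      rw [← Finset.card_union_of_disjoint hQ]
      exact (Finset.card_le_univ _).trans (by simp)
    have side₁ : h ∉ componentVerts G₂ → (h = v → Q₁.card ≤ 3) →
        ∃ h ∈ {p | p ∉ componentVerts G₂ ∨ ∃ k < r, p = x k}, ∃ K,
          (∀ k, K k ⊆ {p | p ∉ componentVerts G₂ ∨ ∃ k < r, p = x k}) ∧ IsWheelModel F₁ h K :=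
      fun hh hc => ⟨h, Or.inl hh, hM.replace S R₁ hh Q₁ (by simp [Q₁]) hc⟩
    have side₂ : h ∉ componentVerts G₁ → (h = v → Q₂.card ≤ 3) →
        ∃ h ∈ {p | p ∉ componentVerts G₁ ∨ ∃ k < s, p = y k}, ∃ K,
          (∀ k, K k ⊆ {p | p ∉ componentVerts G₁ ∨ ∃ k < s, p = y k}) ∧ IsWheelModel F₂ h K :=
      fun hh hc => ⟨h, Or.inl hh, hM.replace S.symm R₂ hh Q₂ (by simp [Q₂]) hc⟩
    rcases S.cover h with hA | hB | rfl
    · exact Or.inl (side₁ (S.disj h hA) fun e => absurd (e ▸ hA) S.v_A)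
    · exact Or.inr (side₂ (fun hA => S.disj h hA hB) fun e => absurd (e ▸ hB) S.v_B)
    -- Only here does the number of spokes limit the path: of seven bags, at most three belong to
    -- one of the two families.
    · by_cases hc : Q₁.card ≤ 3
      · exact Or.inl (side₁ S.v_B fun _ => hc)
      · exact Or.inr (side₂ S.v_A fun _ => by omega)
  · rintro (⟨h, hh, K, hK, hM⟩ | ⟨h, hh, K, hK, hM⟩)
    · exact ⟨h, hM.of_isReplaced S R₁ hh hK⟩
    · exact ⟨h, hM.of_isReplaced S.symm R₂ hh hK⟩
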